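/- **Setting.** Let $f:[0,1]\to(0,\infty)$ be a continuously differentiable probability density, and let $F$ be the distribution with density $f$. Let $c:[0,1]\to(0,\infty)$ be continuously differentiable and strictly increasing, and suppose there is $\theta^*\in(0,1)$ with $c(\theta^*)=\theta^*$, $c(\theta)>\theta$ for $\theta<\theta^*$ and $c(\theta)<\theta$ for $\theta>\theta^*$. Put $\hat c(\theta)=\min\{\theta,c(\theta)\}$. Let $\alpha:[0,1]\to(0,\infty)$ be bounded and measurable. A probability measure $\pi$ on $[0,1]\times[0,1]$, with points $(\theta,x)$, is *feasible* if its first marginal is $F$, if $\int_{[0,1]\times B}(x-\theta)\,d\pi(\theta,x)=0$ for every Borel set $B\subseteq[0,1]$, and if $\pi(\{(\theta,x):x\in B,\ \hat c(\theta)>x\})=0$ for every Borel set $B\subseteq[0,1]$. Assume that full trade is infeasible: no feasible $\pi$ has $\pi(\{x\ge\theta^*\})=1$. The *primal problem* is to maximize $$\int \alpha(\theta)\,\mathbf 1_{\{x\ge\theta^*\}}\,d\pi(\theta,x)$$ over all feasible $\pi$. **Claim.** Suppose that for every $x\in[\theta^*,c(1)]$ the map $\theta\mapsto\alpha(\theta)/(x-\theta)$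 is strictly increasing on $[0,\theta^*]\setminus\{x\}$ (that is, on $[0,\theta^*]$ if $x>\theta^*$, and on $[0,\theta^*)$ if $x=\theta^*$). Then: 1. There are a unique $\underline\theta\in(0,\theta^*)$ and a unique strictly decreasing bijection $g_2:[\underline\theta,\theta^*]\to[\theta^*,c(1)]$, differentiable on $[\underline\theta,\theta^*)$, such that $\varphi(t):=g_2^{-1}(c(t))$ is differentiable on $(\theta^*,1]$ and, for all $t\in(\theta^*,1]$, $$c(t)=\varphi(t)\,\frac{-f(\varphi(t))\varphi'(t)}{-f(\varphi(t))\varphi'(t)+f(t)}+t\,\frac{f(t)}{-f(\varphi(t))\varphi'(t)+f(t)} .$$ Moreover, at every $x\in(\theta^*,c(1)]$ with $c'(c^{-1}(x))>0$ the functions $a:=g_2^{-1}$ and $b:=c^{-1}$ are differentiable, and $$x=a(x)\,\frac{-f(a(x))a'(x)}{-f(a(x))a'(x)+f(b(x))b'(x)}+b(x)\,\frac{f(b(x))b'(x)}{-f(a(x))a'(x)+f(b(x))b'(x)} .$$ (Derivatives at endpoints are one-sided.) 2. The reveal–pool negative assortative matching $\pi^{\mathrm{NAM}}$, defined as the law of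 $(\theta,T(\theta))$ for $\theta\sim F$ with $T(\theta)=\theta$ for $\theta<\underline\theta$, $T(\theta)=g_2(\theta)$ for $\theta\in[\underline\theta,\theta^*]$ and $T(\theta)=c(\theta)$ for $\theta>\theta^*$, is a solution of the primal problem, and it is the only one. -/

import Mathlib

open MeasureTheory Set

namespace Lemons

/-- `f` restricted to `[0,1]` is a strictly positive, continuously differentiable probability
density. (Values outside `[0,1]` are never used.) -/
structure IsTypeDensity (f : ℝ → ℝ) : Prop where
  contDiffOn : ContDiffOn ℝ 1 f (Icc 0 1)
  pos : ∀ θ ∈ Icc (0 : ℝ) 1, 0 < f θ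
  integral_eq_one : ∫ θ in Icc (0 : ℝ) 1, f θ = 1

/-- The cost function `c` on `[0,1]` is positive, continuously differentiable and strictly
increasing, and crosses the diagonal exactly once, at `θs ∈ (0,1)`, from above. -/
structure GainsAtTop (c : ℝ → ℝ) (θs : ℝ) : Prop where
  contDiffOn : ContDiffOn ℝ 1 c (Icc 0 1)
  pos : ∀ θ ∈ Icc (0 : ℝ) 1, 0 < c θ
  strictMonoOn : StrictMonoOn c (Icc 0 1)
  mem_Ioo : θs ∈ Ioo (0 : ℝ) 1
  fixed : c θs = θs
  above : ∀ θ ∈ Ico 0 θs, θ < c θ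
  below : ∀ θ ∈ Ioc θs 1, c θ < θ

/-- The prior distribution of types: density `f` on `[0,1]`. -/
noncomputable def prior (f : ℝ → ℝ) : Measure ℝ :=
  (volume.restrict (Icc 0 1)).withDensity fun θ => ENNReal.ofReal (f θ)

/-- The auxiliary cost `ĉ(θ) = min {θ, c(θ)}`. -/
noncomputable def auxCost (c : ℝ → ℝ) (θ : ℝ) : ℝ := min θ (c θ)

/-- Feasible joint distributions of (type, posterior mean) on `[0,1] × [0,1]`. A point is
`p = (p.1, p.2) = (θ, x)`. -/
structure IsFeasible (f c : ℝ → ℝ) (π : Measure (ℝ × ℝ)) : Prop where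
  isProbabilityMeasure : IsProbabilityMeasure π
  support : π (Icc (0 : ℝ) 1 ×ˢ Icc (0 : ℝ) 1)ᶜ = 0
  /-- Bayes plausibility: the marginal law of the type is the prior. -/
  bayesPlausible : ∀ A : Set ℝ, MeasurableSet A → π {p | p.1 ∈ A} = prior f A
  /-- Martingale condition: the posterior mean given `x` is `x`. -/
  martingale : ∀ B : Set ℝ, MeasurableSet B → ∫ p in {p | p.2 ∈ B}, (p.2 - p.1) ∂π = 0
  /-- Prices as means: almost surely `ĉ(θ) ≤ x`. -/
  pricesAsMeans : ∀ B : Set ℝ, MeasurableSet B → π {p | p.2 ∈ B ∧ p.2 < auxCost c p.1} = 0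

/-- No feasible joint distribution makes all types trade (i.e. puts full mass on `x ≥ θs`). -/
def NoFullTrade (f c : ℝ → ℝ) (θs : ℝ) : Prop :=
  ¬ ∃ π : Measure (ℝ × ℝ), IsFeasible f c π ∧ π {p | θs ≤ p.2} = 1

/-- The weighted volume of trade `∫ α(θ) 1{x ≥ θs} dπ(θ,x)`. -/
noncomputable def tradeVolume (α : ℝ → ℝ) (θs : ℝ) (π : Measure (ℝ × ℝ)) : ℝ :=
  ∫ p, α p.1 * (if θs ≤ p.2 then 1 else 0) ∂π

/-- `π` solves the primal problem: it is feasible and maximizes the weighted volume of trade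
among feasible joint distributions. -/
def IsSolution (f c α : ℝ → ℝ) (θs : ℝ) (π : Measure (ℝ × ℝ)) : Prop :=
  IsFeasible f c π ∧ ∀ π', IsFeasible f c π' → tradeVolume α θs π' ≤ tradeVolume α θs π

/-- The local martingale (Bayes) equation at the parameter `u ∈ S`: an inefficient type `a u`,
decreasing in the parameter, and an efficient type `b u`, increasing in the parameter, are pooled,
with weights proportional to `-f(a) a'` and `f(b) b'`, and the posterior mean is `m u`. The
derivatives are taken within `S` and are required to exist. -/
def PoolingEquationAt (f a b m : ℝ → ℝ) (S : Set ℝ) (u : ℝ) : Prop :=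
  DifferentiableWithinAt ℝ a S u ∧ DifferentiableWithinAt ℝ b S u ∧
  m u =
    a u * ((-f (a u) * derivWithin a S u) /
      (-f (a u) * derivWithin a S u + f (b u) * derivWithin b S u)) +
    b u * ((f (b u) * derivWithin b S u) /
      (-f (a u) * derivWithin a S u + f (b u) * derivWithin b S u))

/-- The inverse `c⁻¹ : [c 0, c 1] → [0,1]`. -/
noncomputable def costInv (c : ℝ → ℝ) : ℝ → ℝ := Function.invFunOn c (Icc 0 1)

/-- The inverse `g⁻¹ : [θs, c 1] → [θl, θs]` of a bijection `g : [θl, θs] → [θs, c 1]`. -/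
noncomputable def matchInv (g : ℝ → ℝ) (θl θs : ℝ) : ℝ → ℝ := Function.invFunOn g (Icc θl θs)

/-- `g : [θl, θs] → [θs, c 1]` is the negative assortative matching function: a strictly decreasing
bijection such that pooling each efficient type `t ∈ (θs, 1]` with the inefficient type `g⁻¹(c t)`
gives the posterior mean `c t`. The pooling equation is parametrized by the efficient type `t`, so
that no derivative of `c⁻¹` is needed. At `t = θs` the two pooled types coincide and the equation
is trivial; `g` need not have a finite slope there. -/
structure IsMatching (f c : ℝ → ℝ) (θs θl : ℝ) (g : ℝ → ℝ) : Prop where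
  mem_Ioo : θl ∈ Ioo 0 θs
  strictAntiOn : StrictAntiOn g (Icc θl θs)
  bijOn : BijOn g (Icc θl θs) (Icc θs (c 1))
  differentiableWithinAt : ∀ θ ∈ Ico θl θs, DifferentiableWithinAt ℝ g (Icc θl θs) θ
  ode : ∀ t ∈ Ioc θs 1,
    PoolingEquationAt f (fun s => matchInv g θl θs (c s)) (fun s => s) c (Icc θs 1) t

/-- The posterior mean assigned to type `θ`: types below `θl` are revealed, types in `[θl, θs]` are
sent to `g θ`, types above `θs` are sent to `c θ`. -/
noncomputable def namMean (c g : ℝ → ℝ) (θs θl θ : ℝ) : ℝ :=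
  if θ < θl then θ else if θ ≤ θs then g θ else c θ

/-- The reveal-pool negative assortative matching joint distribution
`dπ(θ, x) = f(θ) δ_{namMean θ}(x) dθ`. -/
noncomputable def nam (f c g : ℝ → ℝ) (θs θl : ℝ) : Measure (ℝ × ℝ) :=
  (prior f).map fun θ => (θ, namMean c g θs θl θ)

end Lemons

/-!
Write `h t = (t - c t) * f t`. Solved for the derivative, the pooling equation for the curve
`φ t = g⁻¹ (c t)` reads `φ' = -h / ((c - φ) * f φ)`, which is singular at `t = θs`, where `φ = c = θs`.
In terms of the mass `m t = ∫ f` between `φ t` and `θs` it becomes `m' = h / (c - Φ m)`, with `Φ`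
the antitone quantile function; the right-hand side is antitone in `m`. Hence two solutions never
drift apart (`abs_sub_le_of_mul_deriv_sub_nonpos`). This gives uniqueness (`PoolCurve.eqOn`), and
existence as well: the regular solutions started at `m θs = ε > 0` converge uniformly as `ε → 0`
(`exists_curve_of_singular_start`). Pooling along such a curve and revealing the types that it
does not reach is feasible, by the substitution `θ = φ t` (`RevealPool.isFeasible`). If the curve
reached the type `0`, all types would trade, so infeasibility of full trade forces `φ 1 > 0`
(`PoolCurve.pos_of_noFullTrade`), and `g = c ∘ φ⁻¹` is the matching function on `[φ 1, θs]`.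

Optimality is linear programming duality. Let `a = g⁻¹`, and let `q` solve `q' = -q / (x - a x)`
on `(θs, c 1]` with `q (c 1) = α θl / (c 1 - θl)`. Since the derivative of `q x * (x - θ)` has the
sign of `θ - a x`, every inefficient type `θ ≥ θl` strictly prefers the mean `g θ`, and the types
below `θl` prefer `c 1` (`exists_price`); as `α θ / (c 1 - θ)` is strictly increasing, the types
below `θl` are not worth their cost, and those above are. So the slack
`typeValue θ - α θ * 1{x ≥ θs} + q x * (x - θ)` of the dual constraint is nonnegative, and it vanishes only where the
matching prescribes, up to types below `θl` that do not trade (`slack_pos_or`). The price may blow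
up at `θs`, where no feasible distribution has mass (`IsFeasible.ae_snd_ne`), so the duality gap
is computed on the posterior means outside `[θs, s)` as `s` decreases to `θs`. A solution has zero
slack almost everywhere; its types below `θl` do not trade, are at most their posterior mean and
average to it, and are therefore revealed.
-/

namespace Lemons

open Filter Topology NNReal

/-! ### A monotone singular initial value problem -/

/-- Two curves whose derivatives are ordered against their values do not drift apart. -/
lemma abs_sub_le_of_mul_deriv_sub_nonpos {a b : ℝ} {m₁ m₂ d₁ d₂ : ℝ → ℝ}
    (h₁ : ContinuousOn m₁ (Icc a b)) (h₂ : ContinuousOn m₂ (Icc a b))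
    (hd₁ : ∀ t ∈ Ioo a b, HasDerivAt m₁ (d₁ t) t) (hd₂ : ∀ t ∈ Ioo a b, HasDerivAt m₂ (d₂ t) t)
    (hle : ∀ t ∈ Ioo a b, (m₁ t - m₂ t) * (d₁ t - d₂ t) ≤ 0) {t : ℝ} (ht : t ∈ Icc a b) :
    |m₁ t - m₂ t| ≤ |m₁ a - m₂ a| := by
  have hanti : AntitoneOn (fun t => (m₁ t - m₂ t) ^ 2) (Icc a b) := by
    refine antitoneOn_of_hasDerivWithinAt_nonpos (convex_Icc a b)
      (f' := fun t => 2 * ((m₁ t - m₂ t) * (d₁ t - d₂ t))) ((h₁.sub h₂).pow 2) ?_ ?_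
    · intro x hx
      rw [interior_Icc] at hx ⊢
      have := (((hd₁ x hx).sub (hd₂ x hx)).pow 2).hasDerivWithinAt (s := Ioo a b)
      refine this.congr_deriv ?_
      simp
      ring
    · intro x hx
      rw [interior_Icc] at hx
      have := hle x hx
      linarith
  exact sq_le_sq.mp (hanti (left_mem_Icc.mpr (ht.1.trans ht.2)) ht ht.1)

lemma abs_div_sub_div_le {h H x y δ : ℝ} (hH : |h| ≤ H) (hδ : 0 < δ) (hx : δ ≤ x) (hy : δ ≤ y) :
    |h / x - h / y| ≤ H / δ ^ 2 * |x - y| := by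
  have hx0 : 0 < x := hδ.trans_le hx
  have hy0 : 0 < y := hδ.trans_le hy
  have : h / x - h / y = h * (y - x) / (x * y) := by field_simp
  rw [this, abs_div, abs_mul, abs_of_pos (mul_pos hx0 hy0), abs_sub_comm y x, div_mul_eq_mul_div]
  have h0 : 0 ≤ H := (abs_nonneg h).trans hH
  have : δ ^ 2 ≤ x * y := by nlinarith
  gcongr

section SingularStart

variable {a b : ℝ} {h C Φ : ℝ → ℝ} {K : ℝ≥0}

/-- The initial value problem `m' = h / (C - Φ m)`, started at `ε > 0` instead of `0`, where the
denominator stays away from zero. -/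
lemma exists_curve_of_pos_start (hab : a ≤ b) (hh : Continuous h) (h0 : ∀ t ∈ Icc a b, 0 ≤ h t)
    (hC : Continuous C) (hCa : ∀ t ∈ Icc a b, Φ 0 ≤ C t) (hL : LipschitzWith K Φ)
    (hΦ : StrictAnti Φ) {ε : ℝ} (hε : 0 < ε) :
    ∃ m : ℝ → ℝ, m a = ε ∧ ContinuousOn m (Icc a b) ∧ (∀ t ∈ Icc a b, ε ≤ m t) ∧
      ∀ t ∈ Ioo a b, HasDerivAt m (h t / (C t - Φ (m t))) t := by
  obtain ⟨H, hH⟩ := isCompact_Icc.exists_bound_of_continuousOn (s := Icc a b) hh.continuousOn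
  have hH0 : 0 ≤ H := (norm_nonneg _).trans (hH a (left_mem_Icc.mpr hab))
  set δ := Φ 0 - Φ ε with hδ
  have hδ0 : 0 < δ := sub_pos.mpr (hΦ hε)
  have hden : ∀ t ∈ Icc a b, ∀ x, δ ≤ C t - Φ (max x ε) := fun t ht x => by
    have := hCa t ht
    have := hΦ.antitone (le_max_right x ε)
    linarith
  set v : ℝ → ℝ → ℝ := fun t x => h t / (C t - Φ (max x ε)) with hv
  have hbound : ∀ t ∈ Icc a b, ∀ x, ‖v t x‖ ≤ H / δ := fun t ht x => by
    have h1 := hden t ht x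
    have h2 := hH t ht
    rw [hv, norm_div, Real.norm_of_nonneg (hδ0.le.trans h1)]
    gcongr
  have hpl : IsPicardLindelof v (⟨a, left_mem_Icc.mpr hab⟩ : Icc a b) ε
      (Real.toNNReal (H / δ) * Real.toNNReal (b - a)) 0 (Real.toNNReal (H / δ))
      (Real.toNNReal (H / δ ^ 2) * K) := by
    constructor
    · intro t ht
      refine LipschitzWith.lipschitzOnWith (LipschitzWith.of_dist_le_mul fun x y => ?_)
      have h1 := abs_div_sub_div_le (hH t ht) hδ0 (hden t ht x) (hden t ht y)
      have h2 := hL.dist_le_mul (max x ε) (max y ε)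
      rw [Real.dist_eq, Real.dist_eq] at h2
      have h3 : |max x ε - max y ε| ≤ |x - y| := abs_max_sub_max_le_abs x y ε
      have h4 : (0 : ℝ) ≤ H / δ ^ 2 := by positivity
      rw [Real.dist_eq, Real.dist_eq, NNReal.coe_mul, Real.coe_toNNReal _ h4]
      calc |v t x - v t y| ≤ _ := h1
        _ = H / δ ^ 2 * |Φ (max x ε) - Φ (max y ε)| := by
          rw [sub_sub_sub_cancel_left, abs_sub_comm]
        _ ≤ H / δ ^ 2 * (K * |x - y|) := by gcongr; exact h2.trans (by gcongr)
        _ = _ := by ring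
    · intro x _
      exact hh.continuousOn.div (hC.sub continuous_const).continuousOn
        fun t ht => (hδ0.trans_le (hden t ht x)).ne'
    · intro t ht x _
      rw [Real.coe_toNNReal _ (by positivity)]
      exact hbound t ht x
    · simp [Real.coe_toNNReal _ (sub_nonneg.mpr hab), hab]
  obtain ⟨m, hma, hm⟩ := hpl.exists_eq_forall_mem_Icc_hasDerivWithinAt₀
  simp only at hma
  have hcont : ContinuousOn m (Icc a b) := fun t ht => (hm t ht).continuousWithinAt
  have hmono : MonotoneOn m (Icc a b) := by
    refine monotoneOn_of_hasDerivWithinAt_nonneg (convex_Icc a b) hcont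
      (fun t ht => (hm t (interior_subset ht)).mono interior_subset) fun t ht => ?_
    exact div_nonneg (h0 t (interior_subset ht)) (hδ0.le.trans (hden t (interior_subset ht) _))
  have hge : ∀ t ∈ Icc a b, ε ≤ m t := fun t ht =>
    hma ▸ hmono (left_mem_Icc.mpr hab) ht ht.1
  refine ⟨m, hma, hcont, hge, fun t ht => ?_⟩
  have := (hm t (Ioo_subset_Icc_self ht)).hasDerivAt (Icc_mem_nhds ht.1 ht.2)
  simp only [hv] at this
  rwa [max_eq_left (hge t (Ioo_subset_Icc_self ht))] at this

/-- The initial value problem `m' = h / (C - Φ m)`, `m a = 0`, is solvable although the right-hand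
side is singular at the initial point: it is antitone in `m`, so the solutions started at `ε > 0`
depend on `ε` in a nonexpansive way and converge uniformly as `ε → 0`. -/
lemma exists_curve_of_singular_start (hab : a ≤ b) (hh : Continuous h)
    (h0 : ∀ t ∈ Icc a b, 0 ≤ h t) (hC : Continuous C) (hmono : MonotoneOn C (Icc a b))
    (hCa : Φ 0 = C a) (hCpos : ∀ t ∈ Ioc a b, Φ 0 < C t)
    (hL : LipschitzWith K Φ) (hΦ : StrictAnti Φ) :
    ∃ m : ℝ → ℝ, m a = 0 ∧ ContinuousOn m (Icc a b) ∧ (∀ t ∈ Icc a b, 0 ≤ m t) ∧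
      ∀ t ∈ Ioo a b, HasDerivAt m (h t / (C t - Φ (m t))) t := by
  have hCle : ∀ t ∈ Icc a b, Φ 0 ≤ C t := fun t ht =>
    hCa ▸ hmono (left_mem_Icc.mpr hab) ht ht.1
  set e : ℕ → ℝ := fun n => 1 / ((n : ℝ) + 1) with he
  have he0 : ∀ n, 0 < e n := fun n => Nat.one_div_pos_of_nat
  have hetend : Tendsto e atTop (𝓝 0) := tendsto_one_div_add_atTop_nhds_zero_nat
  choose m hma hmc hmge hmd using fun n =>
    exists_curve_of_pos_start hab hh h0 hC hCle hL hΦ (he0 n)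
  have hcontr : ∀ n k, ∀ t ∈ Icc a b, |m n t - m k t| ≤ |e n - e k| := by
    intro n k t ht
    have := abs_sub_le_of_mul_deriv_sub_nonpos (hmc n) (hmc k) (hmd n) (hmd k) ?_ ht
    · rwa [hma, hma] at this
    intro s hs
    have hs' := Ioo_subset_Icc_self hs
    have hpos : ∀ j, 0 < C s - Φ (m j s) := fun j => by
      have := hΦ ((he0 j).trans_le (hmge j s hs'))
      have := hCle s hs'
      linarith
    have hs0 := h0 s hs'
    rcases le_total (m n s) (m k s) with hle | hle
    · refine mul_nonpos_of_nonpos_of_nonneg (sub_nonpos.mpr hle) (sub_nonneg.mpr ?_)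
      exact div_le_div_of_nonneg_left hs0 (hpos n) (by linarith [hΦ.antitone hle])
    · refine mul_nonpos_of_nonneg_of_nonpos (sub_nonneg.mpr hle) (sub_nonpos.mpr ?_)
      exact div_le_div_of_nonneg_left hs0 (hpos k) (by linarith [hΦ.antitone hle])
  have hlim : ∀ t, ∃ y, t ∈ Icc a b → Tendsto (fun n => m n t) atTop (𝓝 y) := by
    intro t
    by_cases ht : t ∈ Icc a b
    · have hcau : CauchySeq fun n => m n t := by
        have := hetend.cauchySeq
        rw [Metric.cauchySeq_iff] at this ⊢
        intro δ hδ
        obtain ⟨N, hN⟩ := this δ hδ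
        exact ⟨N, fun i hi j hj => (hcontr i j t ht).trans_lt (hN i hi j hj)⟩
      obtain ⟨y, hy⟩ := cauchySeq_tendsto_of_complete hcau
      exact ⟨y, fun _ => hy⟩
    · exact ⟨0, fun h => absurd h ht⟩
  choose M hM using hlim
  have hdist : ∀ n, ∀ t ∈ Icc a b, |m n t - M t| ≤ e n := by
    intro n t ht
    have h1 : Tendsto (fun k => |m n t - m k t|) atTop (𝓝 |m n t - M t|) :=
      ((hM t ht).const_sub _).abs
    have h2 : Tendsto (fun k => |e n - e k|) atTop (𝓝 |e n - 0|) := (hetend.const_sub _).abs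
    rw [sub_zero, abs_of_pos (he0 n)] at h2
    exact le_of_tendsto_of_tendsto' h1 h2 fun k => hcontr n k t ht
  have hM0 : ∀ t ∈ Icc a b, 0 ≤ M t := fun t ht =>
    ge_of_tendsto' (hM t ht) fun n => (he0 n).le.trans (hmge n t ht)
  have hunif : TendstoUniformlyOn m M atTop (Icc a b) := by
    rw [Metric.tendstoUniformlyOn_iff]
    intro δ hδ
    filter_upwards [hetend.eventually_lt_const hδ] with n hn t ht
    rw [dist_comm]
    exact (hdist n t ht).trans_lt hn
  have hMa : M a = 0 := by
    refine tendsto_nhds_unique (hM a (left_mem_Icc.mpr hab)) ?_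
    simpa only [hma] using hetend
  refine ⟨M, hMa, hunif.continuousOn (Frequently.of_forall hmc), hM0, fun t ht => ?_⟩
  obtain ⟨s, hs⟩ := exists_between ht.1
  obtain ⟨H, hH⟩ := isCompact_Icc.exists_bound_of_continuousOn (s := Icc a b) hh.continuousOn
  have hH0 : 0 ≤ H := (norm_nonneg _).trans (hH a (left_mem_Icc.mpr hab))
  set δ := C s - Φ 0 with hδ
  have hδ0 : 0 < δ := sub_pos.mpr (hCpos s ⟨hs.1, (hs.2.trans ht.2).le⟩)
  refine hasDerivAt_of_tendstoUniformlyOn (l := atTop) (s := Ioo s b) isOpen_Ioo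
    (f := m) (f' := fun n t => h t / (C t - Φ (m n t))) (g' := fun t => h t / (C t - Φ (M t)))
    ?_ (.of_forall fun n x hx => hmd n x ⟨hs.1.trans hx.1, hx.2⟩)
    (fun x hx => hM x ⟨(hs.1.trans hx.1).le, hx.2.le⟩) ⟨hs.2, ht.2⟩
  have hlim0 : Tendsto (fun n => H / δ ^ 2 * (K * e n)) atTop (𝓝 0) := by
    simpa using (hetend.const_mul (K : ℝ)).const_mul (H / δ ^ 2)
  rw [Metric.tendstoUniformlyOn_iff]
  intro η hη
  filter_upwards [hlim0.eventually_lt_const hη] with n hn x hx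
  have hx' : x ∈ Icc a b := ⟨(hs.1.trans hx.1).le, hx.2.le⟩
  have hge : ∀ y, 0 ≤ y → δ ≤ C x - Φ y := fun y hy => by
    have h1 := hΦ.antitone hy
    have h2 := hmono ⟨hs.1.le, (hs.2.trans ht.2).le⟩ hx' hx.1.le
    linarith
  refine lt_of_le_of_lt ?_ hn
  rw [dist_comm, Real.dist_eq]
  refine (abs_div_sub_div_le (hH x hx') hδ0 (hge _ ((he0 n).le.trans (hmge n x hx')))
    (hge _ (hM0 x hx'))).trans ?_
  gcongr
  have := hL.dist_le_mul (m n x) (M x)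
  rw [Real.dist_eq, Real.dist_eq] at this
  rw [sub_sub_sub_cancel_left, abs_sub_comm]
  exact this.trans (by gcongr; exact hdist n x hx')

end SingularStart

/-- A positive density bounded away from zero has a quantile function, measuring mass to the left
of `x₀`: `Φ m` is the point at which the mass of `[Φ m, x₀]` equals `m`. -/
lemma exists_quantile {F : ℝ → ℝ} (hF : Continuous F) {k : ℝ} (hk : 0 < k) (hFk : ∀ x, k ≤ F x)
    (x₀ : ℝ) :
    ∃ (Φ : ℝ → ℝ) (K : ℝ≥0), Φ 0 = x₀ ∧ StrictAnti Φ ∧ LipschitzWith K Φ ∧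
      ∀ m, HasDerivAt Φ (-(F (Φ m))⁻¹) m := by
  set N : ℝ → ℝ := fun x => ∫ y in x₀..x, F y with hN
  have hNd : ∀ x, HasDerivAt N (F x) x := fun x => hF.integral_hasStrictDerivAt x₀ x |>.hasDerivAt
  have hNdiff : Differentiable ℝ N := fun x => (hNd x).differentiableAt
  have hgrow : ∀ x y, x ≤ y → k * (y - x) ≤ N y - N x := fun x y hxy =>
    mul_sub_le_image_sub_of_le_deriv hNdiff (fun x => by rw [(hNd x).deriv]; exact hFk x) hxy
  have hN0 : N x₀ = 0 := by simp [hN]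
  have htop : Tendsto N atTop atTop := by
    refine tendsto_atTop_mono' _ ?_ ((tendsto_id.const_mul_atTop hk).atTop_add
      (tendsto_const_nhds (x := -(k * x₀))))
    filter_upwards [eventually_ge_atTop x₀] with x hx
    have := hgrow x₀ x hx
    simp only [id]
    linarith
  have hbot : Tendsto N atBot atBot := by
    refine tendsto_atBot_mono' _ ?_ ((tendsto_id.const_mul_atBot hk).atBot_add
      (tendsto_const_nhds (x := -(k * x₀))))
    filter_upwards [eventually_le_atBot x₀] with x hx
    have := hgrow x x₀ hx
    simp only [id]
    linarith
  have hsurj : Function.Surjective N := hNdiff.continuous.surjective htop hbot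
  have hNmono : StrictMono N := fun x y hxy => by
    have := hgrow x y hxy.le
    have := mul_pos hk (sub_pos.mpr hxy)
    linarith
  obtain ⟨G, hG⟩ := hsurj.hasRightInverse
  have hGlip : LipschitzWith (Real.toNNReal k⁻¹) G := by
    refine LipschitzWith.of_dist_le_mul fun x y => ?_
    rw [Real.coe_toNNReal _ (inv_nonneg.mpr hk.le), Real.dist_eq, Real.dist_eq]
    rw [inv_mul_eq_div, le_div_iff₀ hk]
    have hx := hG x
    have hy := hG y
    rcases le_total (G x) (G y) with hle | hle
    · have := hgrow _ _ hle
      rw [hx, hy] at this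
      rw [abs_sub_comm, abs_of_nonneg (sub_nonneg.mpr hle), abs_sub_comm]
      linarith [le_abs_self (y - x)]
    · have := hgrow _ _ hle
      rw [hx, hy] at this
      rw [abs_of_nonneg (sub_nonneg.mpr hle)]
      linarith [le_abs_self (x - y)]
  have hGmono : StrictMono G := fun x y hxy => by
    rw [← hNmono.lt_iff_lt, hG x, hG y]
    exact hxy
  refine ⟨fun m => G (-m), Real.toNNReal k⁻¹, ?_, fun x y hxy => hGmono (neg_lt_neg hxy), ?_, ?_⟩
  · apply hNmono.injective
    rw [hG, hN0, neg_zero]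
  · refine LipschitzWith.of_dist_le_mul fun x y => ?_
    simpa only [dist_neg_neg] using hGlip.dist_le_mul (-x) (-y)
  · intro m
    have h1 : HasDerivAt G (F (G (-m)))⁻¹ (-m) :=
      (hNd (G (-m))).of_local_left_inverse hGlip.continuous.continuousAt
        (hk.trans_le (hFk _)).ne' (.of_forall hG)
    exact (h1.scomp m (hasDerivAt_neg m)).congr_deriv (by simp)

/-! ### Extending the primitives beyond the unit interval -/

/-- The projection of `ℝ` onto `[0,1]`. -/
noncomputable def clip (t : ℝ) : ℝ := max 0 (min 1 t)

lemma clip_mem (t : ℝ) : clip t ∈ Icc (0 : ℝ) 1 :=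
  ⟨le_max_left _ _, max_le zero_le_one (min_le_left _ _)⟩

lemma clip_of_mem {t : ℝ} (ht : t ∈ Icc (0 : ℝ) 1) : clip t = t := by
  rw [clip, min_eq_right ht.2, max_eq_right ht.1]

lemma continuous_clip : Continuous clip :=
  continuous_const.max (continuous_const.min continuous_id)

lemma monotone_clip : Monotone clip := fun _ _ h => max_le_max le_rfl (min_le_min le_rfl h)

lemma _root_.ContinuousOn.comp_clip {F : ℝ → ℝ} (hF : ContinuousOn F (Icc 0 1)) :
    Continuous fun t => F (clip t) :=
  hF.comp_continuous continuous_clip clip_mem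

section Curve

variable {f c φ ψ : ℝ → ℝ} {θs τ t : ℝ}

lemma IsTypeDensity.continuousOn (hf : IsTypeDensity f) : ContinuousOn f (Icc 0 1) :=
  hf.contDiffOn.continuousOn

lemma GainsAtTop.continuousOn (hc : GainsAtTop c θs) : ContinuousOn c (Icc 0 1) :=
  hc.contDiffOn.continuousOn

lemma GainsAtTop.mem_Icc (hc : GainsAtTop c θs) : θs ∈ Icc (0 : ℝ) 1 :=
  Ioo_subset_Icc_self hc.mem_Ioo

lemma GainsAtTop.lt_cost (hc : GainsAtTop c θs) (ht : t ∈ Ioc θs 1) : θs < c t := by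
  have := hc.strictMonoOn hc.mem_Icc ⟨hc.mem_Ioo.1.le.trans ht.1.le, ht.2⟩ ht.1
  rwa [hc.fixed] at this

lemma GainsAtTop.lt_cost_one (hc : GainsAtTop c θs) : θs < c 1 :=
  hc.lt_cost ⟨hc.mem_Ioo.2, le_rfl⟩

lemma GainsAtTop.auxCost_of_le (hc : GainsAtTop c θs) (h0 : 0 ≤ t) (ht : t ≤ θs) :
    auxCost c t = t := by
  rcases ht.eq_or_lt with rfl | h
  · rw [auxCost, hc.fixed, min_self]
  · exact min_eq_left (hc.above t ⟨h0, h⟩).le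

lemma GainsAtTop.auxCost_of_gt (hc : GainsAtTop c θs) (ht : t ∈ Ioc θs 1) :
    auxCost c t = c t :=
  min_eq_right (hc.below t ht).le

/-! ### Pooling curves -/

/-- `φ` assigns to each efficient type `t ∈ [θs, τ]` the inefficient type pooled with it under
negative assortative matching. The differential equation is the pooling equation at posterior mean
`c t` solved for `φ'`; at `t = θs` its right-hand side is `0 / 0`, and nothing is required there
but continuity. -/
structure PoolCurve (f c : ℝ → ℝ) (θs τ : ℝ) (φ : ℝ → ℝ) : Prop where
  start : φ θs = θs
  continuousOn : ContinuousOn φ (Icc θs τ)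
  mapsTo : MapsTo φ (Icc θs τ) (Icc 0 θs)
  deriv : ∀ t ∈ Ioc θs τ, HasDerivWithinAt φ
    (-((t - c t) * f t / ((c t - φ t) * f (φ t)))) (Icc θs τ) t

/-- The pooling curve exists up to the first time `τ` at which the type `0` is matched, or up to
`τ = 1`. -/
lemma exists_poolCurve (hf : IsTypeDensity f) (hc : GainsAtTop c θs) :
    ∃ τ ∈ Ioc θs 1, ∃ φ, PoolCurve f c θs τ φ ∧ (φ τ = 0 ∨ τ = 1) := by
  obtain ⟨x₀, hx₀, hmin⟩ := isCompact_Icc.exists_isMinOn (nonempty_Icc.mpr zero_le_one)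
    hf.continuousOn
  obtain ⟨Φ, K, hΦ0, hΦ, hΦL, hΦd⟩ := exists_quantile hf.continuousOn.comp_clip (hf.pos x₀ hx₀)
    (fun x => hmin (clip_mem x)) θs
  have h0s := hc.mem_Ioo.1
  have hs1 := hc.mem_Ioo.2
  have hclip : ∀ t ∈ Ioc θs 2, clip t ∈ Ioc θs 1 := fun t ht =>
    ⟨lt_max_of_lt_right (lt_min hs1 ht.1), (clip_mem t).2⟩
  have hclips : clip θs = θs := clip_of_mem hc.mem_Icc
  -- The interval is extended to `[θs, 2]` so that the type `1` is an interior point.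
  obtain ⟨m, hm0, hmc, hmge, hmd⟩ := exists_curve_of_singular_start (a := θs) (b := 2)
    (h := fun t => (clip t - c (clip t)) * f (clip t)) (C := fun t => c (clip t)) (Φ := Φ) (K := K)
    (by linarith) ((continuous_clip.sub hc.continuousOn.comp_clip).mul hf.continuousOn.comp_clip)
    (fun t ht => by
      rcases ht.1.eq_or_lt with rfl | h
      · rw [hclips, hc.fixed, sub_self, zero_mul]
      · exact mul_nonneg (sub_nonneg.mpr (hc.below _ (hclip t ⟨h, ht.2⟩)).le)
          (hf.pos _ (clip_mem t)).le)
    hc.continuousOn.comp_clip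
    (fun x _ y _ hxy => hc.strictMonoOn.monotoneOn (clip_mem x) (clip_mem y) (monotone_clip hxy))
    (by rw [hΦ0, hclips, hc.fixed]) (fun t ht => by rw [hΦ0]; exact hc.lt_cost (hclip t ht)) hΦL hΦ
  set φ : ℝ → ℝ := fun t => Φ (m t) with hφ
  have hφc : ContinuousOn φ (Icc θs 2) := hΦL.continuous.comp_continuousOn hmc
  have hφs : φ θs = θs := by simp only [hφ, hm0, hΦ0]
  have hφle : ∀ t ∈ Icc θs 2, φ t ≤ θs := fun t ht => hΦ0 ▸ hΦ.antitone (hmge t ht)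
  have hφd : ∀ t ∈ Ioo θs 2, HasDerivAt φ (-(f (clip (φ t)))⁻¹ *
      ((clip t - c (clip t)) * f (clip t) / (c (clip t) - φ t))) t := fun t ht =>
    (hΦd (m t)).comp t (hmd t ht)
  have hφanti : AntitoneOn φ (Icc θs 2) := by
    refine antitoneOn_of_hasDerivWithinAt_nonpos (convex_Icc _ _) hφc
      (f' := fun t => -(f (clip (φ t)))⁻¹ *
      ((clip t - c (clip t)) * f (clip t) / (c (clip t) - φ t)))
      (fun t ht => (hφd t (by rwa [interior_Icc] at ht)).hasDerivWithinAt) fun t ht => ?_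
    rw [interior_Icc] at ht
    have h1 := hclip t ⟨ht.1, ht.2.le⟩
    have h2 := hc.lt_cost h1
    have h3 := hφle t (Ioo_subset_Icc_self ht)
    have h4 := hf.pos _ (clip_mem t)
    have h5 := hf.pos _ (clip_mem (φ t))
    have h6 := hc.below _ h1
    have h7 : 0 ≤ (clip t - c (clip t)) * f (clip t) / (c (clip t) - φ t) :=
      div_nonneg (mul_nonneg (by linarith) h4.le) (by linarith)
    rw [neg_mul]
    exact neg_nonpos.mpr (mul_nonneg (inv_nonneg.mpr h5.le) h7)
  have hτ : ∃ τ ∈ Ioc θs 1, 0 ≤ φ τ ∧ (φ τ = 0 ∨ τ = 1) := by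
    rcases le_or_gt 0 (φ 1) with h | h
    · exact ⟨1, ⟨hs1, le_rfl⟩, h, .inr rfl⟩
    · obtain ⟨τ, hτ, hτ0⟩ := intermediate_value_Icc' hs1.le
        (hφc.mono (Icc_subset_Icc_right one_le_two)) (show (0 : ℝ) ∈ Icc (φ 1) (φ θs) from
          ⟨h.le, by rw [hφs]; exact h0s.le⟩)
      refine ⟨τ, ⟨lt_of_le_of_ne hτ.1 ?_, hτ.2⟩, hτ0.ge, .inl hτ0⟩
      rintro rfl
      rw [hφs] at hτ0
      exact h0s.ne' hτ0
  obtain ⟨τ, hτ, hτ0, hτ'⟩ := hτ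
  have hsub : Icc θs τ ⊆ Icc θs 2 := Icc_subset_Icc_right (hτ.2.trans one_le_two)
  have hmaps : MapsTo φ (Icc θs τ) (Icc 0 θs) := fun t ht =>
    ⟨hτ0.trans (hφanti (hsub ht) (hsub ⟨hτ.1.le, le_rfl⟩) ht.2), hφle t (hsub ht)⟩
  refine ⟨τ, hτ, φ, ⟨hφs, hφc.mono hsub, hmaps, fun t ht => ?_⟩, hτ'⟩
  have ht1 : clip t = t := clip_of_mem ⟨h0s.le.trans ht.1.le, ht.2.trans hτ.2⟩
  have ht2 : clip (φ t) = φ t :=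
    clip_of_mem (Icc_subset_Icc_right hs1.le (hmaps (Ioc_subset_Icc_self ht)))
  have := (hφd t ⟨ht.1, (ht.2.trans hτ.2).trans_lt one_lt_two⟩).hasDerivWithinAt (s := Icc θs τ)
  rw [ht1, ht2] at this
  refine this.congr_deriv ?_
  rw [neg_mul, inv_mul_eq_div, div_div]

namespace PoolCurve

lemma mem_unit (hc : GainsAtTop c θs) (h : PoolCurve f c θs τ φ) (ht : t ∈ Icc θs τ) :
    φ t ∈ Icc (0 : ℝ) 1 :=
  Icc_subset_Icc_right hc.mem_Ioo.2.le (h.mapsTo ht)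

lemma density_pos (hf : IsTypeDensity f) (hc : GainsAtTop c θs) (h : PoolCurve f c θs τ φ)
    (ht : t ∈ Icc θs τ) : 0 < f (φ t) :=
  hf.pos _ (h.mem_unit hc ht)

lemma lt_cost (hc : GainsAtTop c θs) (h : PoolCurve f c θs τ φ) (hτ : τ ≤ 1)
    (ht : t ∈ Ioc θs τ) : φ t < c t :=
  (h.mapsTo (Ioc_subset_Icc_self ht)).2.trans_lt (hc.lt_cost ⟨ht.1, ht.2.trans hτ⟩)

lemma deriv_neg (hf : IsTypeDensity f) (hc : GainsAtTop c θs) (h : PoolCurve f c θs τ φ)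
    (hτ : τ ≤ 1) (ht : t ∈ Ioc θs τ) :
    -((t - c t) * f t / ((c t - φ t) * f (φ t))) < 0 := by
  have ht1 : t ∈ Ioc θs 1 := ⟨ht.1, ht.2.trans hτ⟩
  have h1 := hc.below t ht1
  have h2 := h.lt_cost hc hτ ht
  have h3 := h.density_pos hf hc (Ioc_subset_Icc_self ht)
  have h4 := hf.pos t ⟨hc.mem_Ioo.1.le.trans ht1.1.le, ht1.2⟩
  exact neg_lt_zero.mpr (div_pos (mul_pos (by linarith) h4) (mul_pos (by linarith) h3))

lemma strictAntiOn (hf : IsTypeDensity f) (hc : GainsAtTop c θs) (h : PoolCurve f c θs τ φ)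
    (hτ : τ ≤ 1) : StrictAntiOn φ (Icc θs τ) := by
  refine strictAntiOn_of_hasDerivWithinAt_neg (convex_Icc _ _) h.continuousOn
    (fun t ht => (h.deriv t ?_).mono interior_subset) fun t ht => h.deriv_neg hf hc hτ ?_
  all_goals
    rw [interior_Icc] at ht
    exact Ioo_subset_Ioc_self ht

lemma bijOn (hf : IsTypeDensity f) (hc : GainsAtTop c θs) (h : PoolCurve f c θs τ φ)
    (hτ : τ ∈ Ioc θs 1) : BijOn φ (Icc θs τ) (Icc (φ τ) θs) := by
  have hanti := h.strictAntiOn hf hc hτ.2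
  refine ⟨fun t ht => ⟨?_, (h.mapsTo ht).2⟩, hanti.injOn, ?_⟩
  · exact hanti.antitoneOn ht (right_mem_Icc.mpr hτ.1.le) ht.2
  · have := intermediate_value_Icc' hτ.1.le h.continuousOn
    rwa [h.start] at this

/-- In terms of the mass `∫ f` between `φ t` and `θs` the equation of a pooling curve is antitone
in the unknown, so its solution is unique despite the singularity at `θs`. -/
lemma eqOn (hf : IsTypeDensity f) (hc : GainsAtTop c θs) (h : PoolCurve f c θs τ φ)
    (h' : PoolCurve f c θs τ ψ) (hτ : τ ∈ Ioc θs 1) : EqOn φ ψ (Icc θs τ) := by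
  set F : ℝ → ℝ := fun x => f (clip x)
  have hF : Continuous F := hf.continuousOn.comp_clip
  set N : ℝ → ℝ := fun x => ∫ y in θs..x, F y with hN
  have hNd : ∀ x, HasDerivAt N (F x) x := fun x => (hF.integral_hasStrictDerivAt θs x).hasDerivAt
  have hNmono : StrictMono N :=
    strictMono_of_hasDerivAt_pos hNd fun x => hf.pos _ (clip_mem x)
  have hNc : Continuous N := continuous_iff_continuousAt.mpr fun x => (hNd x).continuousAt
  have hd : ∀ {χ}, PoolCurve f c θs τ χ → ∀ t ∈ Ioo θs τ,
      HasDerivAt (fun t => N (χ t)) (-((t - c t) * f t / (c t - χ t))) t := by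
    intro χ hχ t ht
    have ht' := Ioo_subset_Ioc_self ht
    have h1 := (hNd (χ t)).comp t ((hχ.deriv t ht').hasDerivAt (Icc_mem_nhds ht.1 ht.2))
    refine h1.congr_deriv ?_
    have h2 := hχ.density_pos hf hc (Ioo_subset_Icc_self ht)
    have h3 := sub_pos.mpr (hχ.lt_cost hc hτ.2 ht')
    simp only [F, clip_of_mem (hχ.mem_unit hc (Ioo_subset_Icc_self ht))]
    field_simp
  intro t ht
  have := abs_sub_le_of_mul_deriv_sub_nonpos (hNc.comp_continuousOn h.continuousOn)
    (hNc.comp_continuousOn h'.continuousOn) (hd h) (hd h') ?_ ht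
  · simp only [Function.comp_apply, h.start, h'.start, sub_self, abs_zero] at this
    exact hNmono.injective (sub_eq_zero.mp (abs_nonpos_iff.mp this))
  intro t ht
  have ht' := Ioo_subset_Ioc_self ht
  have ht1 : t ∈ Ioc θs 1 := ⟨ht.1, ht.2.le.trans hτ.2⟩
  have hh : 0 ≤ (t - c t) * f t :=
    mul_nonneg (sub_nonneg.mpr (hc.below t ht1).le)
      (hf.pos t ⟨hc.mem_Ioo.1.le.trans ht1.1.le, ht1.2⟩).le
  have h1 := h.lt_cost hc hτ.2 ht'
  have h2 := h'.lt_cost hc hτ.2 ht'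
  rw [neg_sub_neg]
  rcases le_total (φ t) (ψ t) with hle | hle
  · refine mul_nonpos_of_nonpos_of_nonneg (sub_nonpos.mpr (hNmono.monotone hle))
      (sub_nonneg.mpr ?_)
    exact div_le_div_of_nonneg_left hh (by linarith) (by linarith)
  · refine mul_nonpos_of_nonneg_of_nonpos (sub_nonneg.mpr (hNmono.monotone hle))
      (sub_nonpos.mpr ?_)
    exact div_le_div_of_nonneg_left hh (by linarith) (by linarith)

end PoolCurve

end Curve

/-! ### The prior -/

section Prior

variable {f c φ T : ℝ → ℝ} {θs τ t : ℝ}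

lemma IsTypeDensity.aemeasurable (hf : IsTypeDensity f) :
    AEMeasurable (fun θ => ENNReal.ofReal (f θ)) (volume.restrict (Icc 0 1)) :=
  (hf.continuousOn.aemeasurable measurableSet_Icc).ennreal_ofReal

lemma prior_absolutelyContinuous : prior f ≪ volume.restrict (Icc 0 1) :=
  withDensity_absolutelyContinuous _ _

lemma IsTypeDensity.isProbabilityMeasure (hf : IsTypeDensity f) :
    IsProbabilityMeasure (prior f) := by
  constructor
  have hint : Integrable f (volume.restrict (Icc 0 1)) := hf.continuousOn.integrableOn_Icc
  have h0 : 0 ≤ᵐ[volume.restrict (Icc 0 1)] f :=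
    (ae_restrict_mem measurableSet_Icc).mono fun θ hθ => (hf.pos θ hθ).le
  rw [prior, withDensity_apply _ MeasurableSet.univ, Measure.restrict_univ,
    ← ofReal_integral_eq_lintegral_ofReal hint h0, hf.integral_eq_one, ENNReal.ofReal_one]

lemma ae_prior_mem_Icc : ∀ᵐ θ ∂prior f, θ ∈ Icc (0 : ℝ) 1 :=
  prior_absolutelyContinuous.ae_le (ae_restrict_mem measurableSet_Icc)

lemma ae_prior_ne (x : ℝ) : ∀ᵐ θ ∂prior f, θ ≠ x :=
  prior_absolutelyContinuous.ae_le (ae_restrict_of_ae (Measure.ae_ne volume x))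

lemma setIntegral_prior (hf : IsTypeDensity f) {A : Set ℝ} (hA : MeasurableSet A)
    (hA1 : A ⊆ Icc 0 1) (F : ℝ → ℝ) :
    ∫ θ in A, F θ ∂prior f = ∫ θ in A, f θ * F θ := by
  rw [prior, setIntegral_withDensity_eq_setIntegral_toReal_smul₀
    (hf.aemeasurable.mono_measure Measure.restrict_le_self) (by simp) _ hA,
    Measure.restrict_restrict_of_subset hA1]
  refine setIntegral_congr_fun hA fun θ hθ => ?_
  simp only [smul_eq_mul, ENNReal.toReal_ofReal (hf.pos θ (hA1 hθ)).le]

namespace PoolCurve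

lemma image_Ioc (hf : IsTypeDensity f) (hc : GainsAtTop c θs) (h : PoolCurve f c θs τ φ)
    (hτ : τ ∈ Ioc θs 1) : φ '' Ioc θs τ = Ico (φ τ) θs := by
  have hb := h.bijOn hf hc hτ
  have hanti := h.strictAntiOn hf hc hτ.2
  ext θ
  constructor
  · rintro ⟨t, ht, rfl⟩
    refine ⟨(hb.mapsTo (Ioc_subset_Icc_self ht)).1, ?_⟩
    have := hanti (left_mem_Icc.mpr hτ.1.le) (Ioc_subset_Icc_self ht) ht.1
    rwa [h.start] at this
  · intro hθ
    obtain ⟨t, ht, rfl⟩ := hb.surjOn (Ico_subset_Icc_self hθ)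
    refine ⟨t, ⟨ht.1.lt_of_ne ?_, ht.2⟩, rfl⟩
    rintro rfl
    exact hθ.2.ne h.start

lemma cases (hf : IsTypeDensity f) (hc : GainsAtTop c θs) (h : PoolCurve f c θs τ φ)
    (hτ : τ ∈ Ioc θs 1) {θ : ℝ} (hθ : θ ∈ Icc (0 : ℝ) 1) (hne : θ ≠ θs) :
    θ ∈ Ico 0 (φ τ) ∨ (∃ t ∈ Ioc θs τ, φ t = θ) ∨ θ ∈ Ioc θs τ ∨ θ ∈ Ioc τ 1 := by
  have him := h.image_Ioc hf hc hτ
  rcases lt_or_ge θ (φ τ) with h1 | h1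
  · exact .inl ⟨hθ.1, h1⟩
  rcases hne.lt_or_gt with h2 | h2
  · have : θ ∈ φ '' Ioc θs τ := him ▸ ⟨h1, h2⟩
    exact .inr (.inl this)
  rcases le_or_gt θ τ with h3 | h3
  · exact .inr (.inr (.inl ⟨h2, h3⟩))
  · exact .inr (.inr (.inr ⟨h3, hθ.2⟩))

lemma ae_of_forall (hf : IsTypeDensity f) (hc : GainsAtTop c θs) (h : PoolCurve f c θs τ φ)
    (hτ : τ ∈ Ioc θs 1) {P : ℝ → Prop} (h1 : ∀ θ ∈ Ico 0 (φ τ), P θ)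
    (h2 : ∀ t ∈ Ioc θs τ, P (φ t)) (h3 : ∀ t ∈ Ioc θs τ, P t) (h4 : ∀ θ ∈ Ioc τ 1, P θ) :
    ∀ᵐ θ ∂prior f, P θ := by
  filter_upwards [ae_prior_mem_Icc, ae_prior_ne θs] with θ hθ hne
  rcases h.cases hf hc hτ hθ hne with h | ⟨t, ht, rfl⟩ | h | h
  exacts [h1 θ h, h2 t ht, h3 θ h, h4 θ h]

end PoolCurve

/-! ### Reveal–pool distributions are feasible -/

/-- `T` sends the two types pooled by the curve `φ` to their posterior mean `c t`, and reveals all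
types that the curve does not reach. (The value at `θs` is left free.) -/
structure RevealPool (c φ : ℝ → ℝ) (θs τ : ℝ) (T : ℝ → ℝ) : Prop where
  efficient : ∀ t ∈ Ioc θs τ, T t = c t
  inefficient : ∀ t ∈ Ioc θs τ, T (φ t) = c t
  reveal_low : ∀ θ ∈ Ico 0 (φ τ), T θ = θ
  reveal_high : ∀ θ ∈ Ioc τ 1, T θ = θ

namespace RevealPool

lemma aemeasurable (hf : IsTypeDensity f) (hc : GainsAtTop c θs) (h : PoolCurve f c θs τ φ)
    (hτ : τ ∈ Ioc θs 1) (hT : RevealPool c φ θs τ T) : AEMeasurable T (prior f) := by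
  refine AEMeasurable.mono_ac ?_ prior_absolutelyContinuous
  have hanti := h.strictAntiOn hf hc hτ.2
  have hsub : Ioc θs τ ⊆ Icc 0 1 := fun t ht =>
    ⟨hc.mem_Ioo.1.le.trans ht.1.le, ht.2.trans hτ.2⟩
  have h1 : AEMeasurable T (volume.restrict (Ico 0 (φ τ))) :=
    aemeasurable_restrict_of_monotoneOn measurableSet_Ico fun x hx y hy hxy => by
      rwa [hT.reveal_low x hx, hT.reveal_low y hy]
  have h2 : AEMeasurable T (volume.restrict (Ico (φ τ) θs)) := by
    rw [← h.image_Ioc hf hc hτ]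
    refine aemeasurable_restrict_of_antitoneOn
      (by rw [h.image_Ioc hf hc hτ]; exact measurableSet_Ico) ?_
    rintro _ ⟨s, hs, rfl⟩ _ ⟨t, ht, rfl⟩ hst
    rw [hT.inefficient s hs, hT.inefficient t ht]
    exact hc.strictMonoOn.monotoneOn (hsub ht) (hsub hs)
      ((hanti.le_iff_ge (Ioc_subset_Icc_self hs) (Ioc_subset_Icc_self ht)).mp hst)
  have h3 : AEMeasurable T (volume.restrict (Ioc θs τ)) :=
    aemeasurable_restrict_of_monotoneOn measurableSet_Ioc fun x hx y hy hxy => by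
      rw [hT.efficient x hx, hT.efficient y hy]
      exact hc.strictMonoOn.monotoneOn (hsub hx) (hsub hy) hxy
  have h4 : AEMeasurable T (volume.restrict (Ioc τ 1)) :=
    aemeasurable_restrict_of_monotoneOn measurableSet_Ioc fun x hx y hy hxy => by
      rwa [hT.reveal_high x hx, hT.reveal_high y hy]
  have h5 : AEMeasurable T (volume.restrict {θs}) := by
    rw [Measure.restrict_eq_zero.mpr (by simp)]
    exact aemeasurable_zero_measure
  have hall := aemeasurable_union_iff.mpr ⟨h5, aemeasurable_union_iff.mpr ⟨h1,
    aemeasurable_union_iff.mpr ⟨h2, aemeasurable_union_iff.mpr ⟨h3, h4⟩⟩⟩⟩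
  refine hall.mono_measure (Measure.restrict_mono (fun θ hθ => ?_) le_rfl)
  rcases eq_or_ne θ θs with rfl | hne
  · exact .inl rfl
  rcases h.cases hf hc hτ hθ hne with h' | h' | h' | h'
  · exact .inr (.inl h')
  · exact .inr (.inr (.inl (h.image_Ioc hf hc hτ ▸ h')))
  · exact .inr (.inr (.inr (.inl h')))
  · exact .inr (.inr (.inr (.inr h')))

/-- The pooling equation, integrated by substituting `θ = φ t`: over any set of posterior means the
surplus of the inefficient types cancels the deficit of the efficient ones. -/
lemma integral_eq_zero (hf : IsTypeDensity f) (hc : GainsAtTop c θs) (h : PoolCurve f c θs τ φ)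
    (hτ : τ ∈ Ioc θs 1) (hT : RevealPool c φ θs τ T) {B : Set ℝ}
    (hint : Integrable (fun θ => B.indicator (fun x => x - θ) (T θ)) (prior f)) :
    ∫ θ, B.indicator (fun x => x - θ) (T θ) ∂prior f = 0 := by
  have him := h.image_Ioc hf hc hτ
  have hφτ := (h.mapsTo (right_mem_Icc.mpr hτ.1.le)).1
  have hsub : Ioc θs τ ⊆ Icc 0 1 := fun t ht =>
    ⟨hc.mem_Ioo.1.le.trans ht.1.le, ht.2.trans hτ.2⟩
  have hsub' : Ico (φ τ) θs ⊆ Icc 0 1 := fun t ht =>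
    ⟨hφτ.trans ht.1, ht.2.le.trans hc.mem_Ioo.2.le⟩
  have hzero : ∀ᵐ θ ∂prior f, θ ∉ Ico (φ τ) θs ∪ Ioc θs τ →
      B.indicator (fun x => x - θ) (T θ) = 0 := by
    have hrev : ∀ θ, T θ = θ → B.indicator (fun x => x - θ) (T θ) = 0 := fun θ hθ => by
      rw [hθ]
      by_cases hB : θ ∈ B
      · rw [indicator_of_mem hB, sub_self]
      · rw [indicator_of_notMem hB]
    refine h.ae_of_forall hf hc hτ (fun θ hθ _ => hrev θ (hT.reveal_low θ hθ)) (fun t ht hn => ?_)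
      (fun t ht hn => absurd (.inr ht) hn) (fun θ hθ _ => hrev θ (hT.reveal_high θ hθ))
    exact absurd (.inl (him ▸ mem_image_of_mem φ ht)) hn
  rw [← setIntegral_eq_integral_of_ae_compl_eq_zero hzero,
    setIntegral_union (Set.disjoint_left.mpr fun x hx hx' => hx.2.not_gt hx'.1) measurableSet_Ioc
      hint.integrableOn hint.integrableOn, setIntegral_prior hf measurableSet_Ico hsub',
    setIntegral_prior hf measurableSet_Ioc hsub, ← him,
    integral_image_eq_integral_abs_deriv_smul measurableSet_Ioc
      (fun t ht => (h.deriv t ht).mono Ioc_subset_Icc_self)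
      ((h.strictAntiOn hf hc hτ.2).injOn.mono Ioc_subset_Icc_self), ← neg_eq_iff_add_eq_zero,
    ← integral_neg]
  refine setIntegral_congr_fun measurableSet_Ioc fun t ht => ?_
  rw [abs_of_neg (h.deriv_neg hf hc hτ.2 ht), hT.inefficient t ht, hT.efficient t ht]
  by_cases hB : c t ∈ B
  · have h1 := (h.density_pos hf hc (Ioc_subset_Icc_self ht)).ne'
    have h2 := (sub_pos.mpr (h.lt_cost hc hτ.2 ht)).ne'
    simp only [indicator_of_mem hB, smul_eq_mul, neg_neg]
    field_simp
    ring
  · simp only [indicator_of_notMem hB, smul_zero, mul_zero, neg_zero]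

/-- Pooling along a pooling curve and revealing all other types is feasible. -/
lemma isFeasible (hf : IsTypeDensity f) (hc : GainsAtTop c θs) (h : PoolCurve f c θs τ φ)
    (hτ : τ ∈ Ioc θs 1) (hT : RevealPool c φ θs τ T) :
    IsFeasible f c ((prior f).map fun θ => (θ, T θ)) := by
  have hTm := hT.aemeasurable hf hc h hτ
  have hm : AEMeasurable (fun θ => (θ, T θ)) (prior f) := aemeasurable_id.prodMk hTm
  have hprob := hf.isProbabilityMeasure
  have hsub : Ioc θs τ ⊆ Icc 0 1 := fun t ht =>
    ⟨hc.mem_Ioo.1.le.trans ht.1.le, ht.2.trans hτ.2⟩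
  have hφτ := h.mapsTo (right_mem_Icc.mpr hτ.1.le)
  have hcm : ∀ t ∈ Ioc θs τ, c t ∈ Icc (0 : ℝ) 1 := fun t ht =>
    ⟨(hc.pos t (hsub ht)).le, (hc.below t ⟨ht.1, ht.2.trans hτ.2⟩).le.trans (hsub ht).2⟩
  have hT01 : ∀ᵐ θ ∂prior f, T θ ∈ Icc (0 : ℝ) 1 :=
    h.ae_of_forall hf hc hτ
      (fun θ hθ => by
        rw [hT.reveal_low θ hθ]
        exact ⟨hθ.1, hθ.2.le.trans (hφτ.2.trans hc.mem_Ioo.2.le)⟩)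
      (fun t ht => by rw [hT.inefficient t ht]; exact hcm t ht)
      (fun t ht => by rw [hT.efficient t ht]; exact hcm t ht)
      (fun θ hθ => by
        rw [hT.reveal_high θ hθ]
        exact ⟨hc.mem_Ioo.1.le.trans (hτ.1.le.trans hθ.1.le), hθ.2⟩)
  have hS : MeasurableSet (Icc (0 : ℝ) 1 ×ˢ Icc (0 : ℝ) 1) :=
    measurableSet_Icc.prod measurableSet_Icc
  refine ⟨Measure.isProbabilityMeasure_map hm, ?_, fun A hA => ?_, fun B hB => ?_, fun B hB => ?_⟩
  · rw [← mem_ae_iff]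
    refine (ae_map_iff hm hS).mpr ?_
    filter_upwards [ae_prior_mem_Icc, hT01] with θ h1 h2 using ⟨h1, h2⟩
  · exact Measure.map_apply_of_aemeasurable hm (measurable_fst hA)
  · have hBm : MeasurableSet {p : ℝ × ℝ | p.2 ∈ B} := measurable_snd hB
    have hD : Measurable ({p : ℝ × ℝ | p.2 ∈ B}.indicator fun p => p.2 - p.1) :=
      (measurable_snd.sub measurable_fst).indicator hBm
    rw [← integral_indicator hBm, integral_map hm hD.aestronglyMeasurable]
    have heq : (fun θ => ({p : ℝ × ℝ | p.2 ∈ B}.indicator fun p => p.2 - p.1) (θ, T θ)) =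
        fun θ => B.indicator (fun x => x - θ) (T θ) := by
      ext θ
      by_cases hx : T θ ∈ B
      · rw [indicator_of_mem hx, indicator_of_mem (show (θ, T θ) ∈ {p : ℝ × ℝ | p.2 ∈ B} from hx)]
      · rw [indicator_of_notMem hx,
          indicator_of_notMem (show (θ, T θ) ∉ {p : ℝ × ℝ | p.2 ∈ B} from hx)]
    rw [heq]
    refine hT.integral_eq_zero hf hc h hτ ?_
    rw [← heq]
    refine Integrable.of_bound (hD.comp_aemeasurable hm).aestronglyMeasurable 1 ?_
    filter_upwards [ae_prior_mem_Icc, hT01] with θ h1 h2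
    refine (norm_indicator_le_norm_self _ _).trans ?_
    rw [Real.norm_eq_abs, abs_le]
    constructor <;> linarith [h1.1, h1.2, h2.1, h2.2]
  · have hmeas : MeasurableSet {p : ℝ × ℝ | min p.1 (c (clip p.1)) ≤ p.2} :=
      measurableSet_le (measurable_fst.min
        (hc.continuousOn.comp_clip.measurable.comp measurable_fst)) measurable_snd
    have key : ∀ᵐ p ∂(prior f).map (fun θ => (θ, T θ)),
        p.1 ∈ Icc (0 : ℝ) 1 ∧ min p.1 (c (clip p.1)) ≤ p.2 := by
      refine (ae_map_iff hm ((measurable_fst measurableSet_Icc).inter hmeas)).mpr ?_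
      filter_upwards [ae_prior_mem_Icc, h.ae_of_forall (P := fun θ => min θ (c θ) ≤ T θ) hf hc hτ
        (fun θ hθ => by rw [hT.reveal_low θ hθ]; exact min_le_left _ _)
        (fun t ht => by
          rw [hT.inefficient t ht]
          exact (min_le_left _ _).trans (h.lt_cost hc hτ.2 ht).le)
        (fun t ht => by rw [hT.efficient t ht]; exact min_le_right _ _)
        (fun θ hθ => by rw [hT.reveal_high θ hθ]; exact min_le_left _ _)] with θ h1 h2
      exact ⟨h1, by simpa only [mem_ofPred_eq, clip_of_mem h1] using h2⟩
    refine measure_mono_null (fun p hp => ?_) (ae_iff.mp key)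
    rintro ⟨h1, h2⟩
    rw [clip_of_mem h1] at h2
    exact (hp.2.trans_le h2).false

end RevealPool

/-- If the curve matched the lowest type, then all types could trade. -/
lemma PoolCurve.pos_of_noFullTrade (hf : IsTypeDensity f) (hc : GainsAtTop c θs)
    (hfull : NoFullTrade f c θs) (h : PoolCurve f c θs τ φ) (hτ : τ ∈ Ioc θs 1) : 0 < φ τ := by
  have hb := h.bijOn hf hc hτ
  refine (h.mapsTo (right_mem_Icc.mpr hτ.1.le)).1.lt_of_ne fun h0 => hfull ?_
  set T : ℝ → ℝ := fun θ =>
    if θ ≤ θs then c (Function.invFunOn φ (Icc θs τ) θ) else if θ ≤ τ then c θ else θ with hTdef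
  have hT : RevealPool c φ θs τ T := by
    constructor
    · intro t ht
      simp only [hTdef, if_neg ht.1.not_ge, if_pos ht.2]
    · intro t ht
      have ht' := Ioc_subset_Icc_self ht
      simp only [hTdef, if_pos (h.mapsTo ht').2, hb.injOn.leftInvOn_invFunOn ht']
    · intro θ hθ
      rw [← h0] at hθ
      exact absurd hθ.2 hθ.1.not_gt
    · intro θ hθ
      simp only [hTdef, if_neg (hτ.1.trans hθ.1).not_ge, if_neg hθ.1.not_ge]
  have hfeas := hT.isFeasible hf hc h hτ
  refine ⟨_, hfeas, ?_⟩
  have := hfeas.isProbabilityMeasure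
  have hmeas : MeasurableSet {p : ℝ × ℝ | θs ≤ p.2} :=
    measurableSet_le measurable_const measurable_snd
  rw [← mem_ae_iff_prob_eq_one hmeas]
  refine (ae_map_iff (aemeasurable_id.prodMk (hT.aemeasurable hf hc h hτ)) hmeas).mpr ?_
  have hge : ∀ t ∈ Ioc θs τ, θs ≤ c t := fun t ht => (hc.lt_cost ⟨ht.1, ht.2.trans hτ.2⟩).le
  refine h.ae_of_forall hf hc hτ (fun θ hθ => ?_) (fun t ht => ?_) (fun t ht => ?_)
    fun θ hθ => ?_
  · rw [← h0] at hθ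
    exact absurd hθ.2 hθ.1.not_gt
  · rw [hT.inefficient t ht]
    exact hge t ht
  · rw [hT.efficient t ht]
    exact hge t ht
  · rw [hT.reveal_high θ hθ]
    exact hτ.1.le.trans hθ.1.le

end Prior

/-! ### Inverses of monotone bijections between intervals -/

section Inverse

variable {u : ℝ → ℝ} {s t : Set ℝ} {a b p q : ℝ}

lemma _root_.StrictMonoOn.continuousOn_of_bijOn (hu : StrictMonoOn u (Icc a b))
    (hb : BijOn u (Icc a b) (Icc p q)) : ContinuousOn u (Icc a b) := by
  rw [continuousOn_iff_continuous_domRestrict]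
  have : OrdConnected (u '' Icc a b) := hb.image_eq ▸ ordConnected_Icc
  exact continuous_subtype_val.comp (hu.orderIso u (Icc a b)).continuous

lemma _root_.StrictAntiOn.continuousOn_of_bijOn (hu : StrictAntiOn u (Icc a b))
    (hb : BijOn u (Icc a b) (Icc p q)) : ContinuousOn u (Icc a b) := by
  have hb' : BijOn (fun x => -u x) (Icc a b) (Icc (-q) (-p)) := by
    refine ⟨fun x hx => ?_, fun x hx y hy hxy => hb.injOn hx hy (neg_injective hxy), fun y hy => ?_⟩
    · have := hb.mapsTo hx
      exact ⟨neg_le_neg this.2, neg_le_neg this.1⟩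
    · obtain ⟨x, hx, hxy⟩ := hb.surjOn (show -y ∈ Icc p q from
        ⟨le_neg_of_le_neg hy.2, neg_le_of_neg_le hy.1⟩)
      exact ⟨x, hx, by simp only [hxy, neg_neg]⟩
  have := (StrictMonoOn.continuousOn_of_bijOn (fun x hx y hy hxy => neg_lt_neg (hu hx hy hxy))
    hb').neg
  simpa only [Pi.neg_def, neg_neg] using this

lemma _root_.Set.BijOn.bijOn_invFunOn (hb : BijOn u s t) : BijOn (Function.invFunOn u s) t s :=
  BijOn.symm hb.invOn_invFunOn.symm hb

lemma _root_.StrictMonoOn.invFunOn (hu : StrictMonoOn u s) (hb : BijOn u s t) :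
    StrictMonoOn (Function.invFunOn u s) t := fun x hx y hy hxy => by
  have hi := hb.bijOn_invFunOn.mapsTo
  rw [← hu.lt_iff_lt (hi hx) (hi hy)]
  rwa [hb.invOn_invFunOn.2 hx, hb.invOn_invFunOn.2 hy]

lemma _root_.StrictAntiOn.invFunOn (hu : StrictAntiOn u s) (hb : BijOn u s t) :
    StrictAntiOn (Function.invFunOn u s) t := fun x hx y hy hxy => by
  have hi := hb.bijOn_invFunOn.mapsTo
  rw [← hu.lt_iff_gt (hi hx) (hi hy)]
  rwa [hb.invOn_invFunOn.2 hx, hb.invOn_invFunOn.2 hy]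

lemma _root_.HasDerivWithinAt.of_leftInverse {𝕜 : Type*} [NontriviallyNormedField 𝕜] {u v : 𝕜 → 𝕜}
    {s t : Set 𝕜} {x u' : 𝕜} (hv : ContinuousWithinAt v t x) (hmaps : MapsTo v t s) (hx : x ∈ t)
    (hu : HasDerivWithinAt u u' s (v x)) (hu' : u' ≠ 0) (hinv : ∀ y ∈ t, u (v y) = y) :
    HasDerivWithinAt v u'⁻¹ t x := by
  have hf : HasFDerivWithinAt u
      (ContinuousLinearEquiv.unitsEquivAut 𝕜 (Units.mk0 u' hu') : 𝕜 →L[𝕜] 𝕜) s (v x) := by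
    refine hu.hasFDerivWithinAt.congr_fderiv ?_
    ext
    simp
  have := hf.of_local_left_inverse
    (tendsto_nhdsWithin_iff.mpr ⟨hv, eventually_nhdsWithin_of_forall hmaps⟩) hx
    (eventually_nhdsWithin_of_forall hinv)
  exact this.hasDerivWithinAt.congr_deriv (by simp)

end Inverse

/-- The posterior mean `m` of a pool of weight `A` at `a` and weight `B` at `b`. -/
lemma eq_weighted_mean_iff {m a b A B : ℝ} (h : A + B ≠ 0) :
    m = a * (A / (A + B)) + b * (B / (A + B)) ↔ (m - a) * A = (b - m) * B := by
  field_simp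
  constructor <;> intro h <;> linarith

/-! ### Matching functions and pooling curves -/

section Matching

variable {f c φ g T : ℝ → ℝ} {θs θl t x : ℝ}

lemma GainsAtTop.cost_bijOn (hc : GainsAtTop c θs) : BijOn c (Icc θs 1) (Icc θs (c 1)) := by
  have hsub : Icc θs 1 ⊆ Icc 0 1 := Icc_subset_Icc_left hc.mem_Ioo.1.le
  have hm := hc.strictMonoOn.mono hsub
  have h1 : θs ≤ 1 := hc.mem_Ioo.2.le
  refine ⟨fun t ht => ⟨?_, hm.monotoneOn ht (right_mem_Icc.mpr h1) ht.2⟩, hm.injOn, ?_⟩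
  · have := hm.monotoneOn (left_mem_Icc.mpr h1) ht ht.1
    rwa [hc.fixed] at this
  · have := intermediate_value_Icc h1 (hc.continuousOn.mono hsub)
    rwa [hc.fixed] at this

/-- The curve `t ↦ g⁻¹ (c t)` of a matching function is a pooling curve. -/
lemma IsMatching.poolCurve (hf : IsTypeDensity f) (hc : GainsAtTop c θs)
    (hg : IsMatching f c θs θl g) :
    PoolCurve f c θs 1 (fun t => matchInv g θl θs (c t)) ∧ matchInv g θl θs (c 1) = θl ∧
      ∀ t ∈ Icc θs 1, g (matchInv g θl θs (c t)) = c t := by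
  set φ : ℝ → ℝ := fun t => matchInv g θl θs (c t) with hφ
  have hs1 := hc.mem_Ioo.2.le
  have hsub : Icc θs 1 ⊆ Icc 0 1 := Icc_subset_Icc_left hc.mem_Ioo.1.le
  have hcb := hc.cost_bijOn
  have hgb := hg.bijOn.bijOn_invFunOn
  have hganti := hg.strictAntiOn.invFunOn hg.bijOn
  have hφb : BijOn φ (Icc θs 1) (Icc θl θs) := hgb.comp hcb
  have hφanti : StrictAntiOn φ (Icc θs 1) := fun x hx y hy hxy =>
    hganti (hcb.mapsTo hx) (hcb.mapsTo hy) (hc.strictMonoOn (hsub hx) (hsub hy) hxy)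
  have hll := hg.mem_Ioo.2.le
  have hφs : φ θs = θs := by
    obtain ⟨t, ht, hts⟩ := hφb.surjOn (right_mem_Icc.mpr hll)
    refine le_antisymm (hφb.mapsTo (left_mem_Icc.mpr hs1)).2 ?_
    have := hφanti.antitoneOn (left_mem_Icc.mpr hs1) ht ht.1
    rwa [hts] at this
  have hφ1 : φ 1 = θl := by
    obtain ⟨t, ht, hts⟩ := hφb.surjOn (left_mem_Icc.mpr hll)
    refine le_antisymm ?_ (hφb.mapsTo (right_mem_Icc.mpr hs1)).1
    have := hφanti.antitoneOn ht (right_mem_Icc.mpr hs1) ht.2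
    rwa [hts] at this
  refine ⟨⟨hφs, hφanti.continuousOn_of_bijOn hφb,
    fun t ht => ⟨hg.mem_Ioo.1.le.trans (hφb.mapsTo ht).1, (hφb.mapsTo ht).2⟩, fun t ht => ?_⟩, hφ1,
    fun t ht => hg.bijOn.invOn_invFunOn.2 (hcb.mapsTo ht)⟩
  have ht' := Ioc_subset_Icc_self ht
  obtain ⟨hd, -, heq⟩ := hg.ode t ht
  have hφt := hφb.mapsTo ht'
  have hfφ : 0 < f (φ t) :=
    hf.pos _ ⟨hg.mem_Ioo.1.le.trans hφt.1, hφt.2.trans hs1⟩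
  have hft := hf.pos t (hsub ht')
  have hD : derivWithin φ (Icc θs 1) t ≤ 0 := hφanti.antitoneOn.derivWithin_nonpos
  have hct : φ t < c t := hφt.2.trans_lt (hc.lt_cost ht)
  have hid : derivWithin (fun s : ℝ => s) (Icc θs 1) t = 1 :=
    derivWithin_id' _ _ (uniqueDiffOn_Icc hc.mem_Ioo.2 t ht')
  rw [hid, mul_one] at heq
  have h0 : 0 ≤ -f (φ t) * derivWithin φ (Icc θs 1) t := by nlinarith
  rw [eq_weighted_mean_iff (by positivity)] at heq
  refine hd.hasDerivWithinAt.congr_deriv ?_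
  have h1 : 0 < c t - φ t := sub_pos.mpr hct
  change (c t - φ t) * (-f (φ t) * derivWithin φ (Icc θs 1) t) = (t - c t) * f t at heq
  change derivWithin φ (Icc θs 1) t = _
  rw [← heq]
  field_simp

namespace PoolCurve

/-- The matching function `c ∘ φ⁻¹` of a pooling curve `φ`. -/
noncomputable def matching (c φ : ℝ → ℝ) (θs : ℝ) : ℝ → ℝ :=
  fun θ => c (Function.invFunOn φ (Icc θs 1) θ)

lemma matching_apply (hf : IsTypeDensity f) (hc : GainsAtTop c θs) (h : PoolCurve f c θs 1 φ)
    (ht : t ∈ Icc θs 1) : matching c φ θs (φ t) = c t := by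
  rw [matching, (h.strictAntiOn hf hc le_rfl).injOn.leftInvOn_invFunOn ht]

lemma matching_strictAntiOn (hf : IsTypeDensity f) (hc : GainsAtTop c θs)
    (h : PoolCurve f c θs 1 φ) : StrictAntiOn (matching c φ θs) (Icc (φ 1) θs) := by
  have hb := h.bijOn hf hc ⟨hc.mem_Ioo.2, le_rfl⟩
  have hi := (h.strictAntiOn hf hc le_rfl).invFunOn hb
  have hsub : Icc θs 1 ⊆ Icc 0 1 := Icc_subset_Icc_left hc.mem_Ioo.1.le
  exact fun x hx y hy hxy => hc.strictMonoOn (hsub (hb.bijOn_invFunOn.mapsTo hy))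
    (hsub (hb.bijOn_invFunOn.mapsTo hx)) (hi hx hy hxy)

lemma matching_bijOn (hf : IsTypeDensity f) (hc : GainsAtTop c θs)
    (h : PoolCurve f c θs 1 φ) : BijOn (matching c φ θs) (Icc (φ 1) θs) (Icc θs (c 1)) :=
  hc.cost_bijOn.comp (h.bijOn hf hc ⟨hc.mem_Ioo.2, le_rfl⟩).bijOn_invFunOn

lemma matchInv_matching (hf : IsTypeDensity f) (hc : GainsAtTop c θs)
    (h : PoolCurve f c θs 1 φ) (ht : t ∈ Icc θs 1) :
    matchInv (matching c φ θs) (φ 1) θs (c t) = φ t := by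
  have hb := h.bijOn hf hc ⟨hc.mem_Ioo.2, le_rfl⟩
  rw [← h.matching_apply hf hc ht]
  exact (h.matching_bijOn hf hc).injOn.leftInvOn_invFunOn (hb.mapsTo ht)

lemma isMatching (hf : IsTypeDensity f) (hc : GainsAtTop c θs) (h : PoolCurve f c θs 1 φ)
    (hpos : 0 < φ 1) : IsMatching f c θs (φ 1) (matching c φ θs) := by
  have hs1 := hc.mem_Ioo.2
  have hanti := h.strictAntiOn hf hc le_rfl
  have hb := h.bijOn hf hc ⟨hs1, le_rfl⟩
  have hi := hb.bijOn_invFunOn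
  have hsub : Icc θs 1 ⊆ Icc 0 1 := Icc_subset_Icc_left hc.mem_Ioo.1.le
  have h1s : φ 1 < θs := by
    have := hanti (left_mem_Icc.mpr hs1.le) (right_mem_Icc.mpr hs1.le) hs1
    rwa [h.start] at this
  refine ⟨⟨hpos, h1s⟩, h.matching_strictAntiOn hf hc, h.matching_bijOn hf hc, fun θ hθ => ?_,
    fun t ht => ?_⟩
  · have hθ' := Ico_subset_Icc_self hθ
    have hti := hi.mapsTo hθ'
    have hφi : φ (Function.invFunOn φ (Icc θs 1) θ) = θ := hb.invOn_invFunOn.2 hθ'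
    have ht : Function.invFunOn φ (Icc θs 1) θ ∈ Ioc θs 1 := by
      refine ⟨hti.1.lt_of_ne fun hEq => ?_, hti.2⟩
      rw [← hEq, h.start] at hφi
      exact hθ.2.ne' hφi
    have hd := HasDerivWithinAt.of_leftInverse
      ((hanti.invFunOn hb).continuousOn_of_bijOn hi θ hθ') hi.mapsTo hθ' (h.deriv _ ht)
      (h.deriv_neg hf hc le_rfl ht).ne fun y hy => hb.invOn_invFunOn.2 hy
    exact ((hc.contDiffOn.differentiableOn one_ne_zero _ (hsub hti)).mono hsub).comp θ
      hd.differentiableWithinAt hi.mapsTo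
  · have ht' := Ioc_subset_Icc_self ht
    have hEq : EqOn (fun s => matchInv (matching c φ θs) (φ 1) θs (c s)) φ (Icc θs 1) :=
      fun s hs => h.matchInv_matching hf hc hs
    have hd := (h.deriv t ht).congr hEq (hEq ht')
    have hu := uniqueDiffOn_Icc hs1 t ht'
    refine ⟨hd.differentiableWithinAt, differentiableWithinAt_id, ?_⟩
    rw [hd.derivWithin hu, derivWithin_id' _ _ hu]
    simp only [h.matchInv_matching hf hc ht']
    have h1 := h.density_pos hf hc ht'
    have h2 := sub_pos.mpr (h.lt_cost hc le_rfl ht)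
    have h3 := hf.pos t (hsub ht')
    have h4 := h.deriv_neg hf hc le_rfl ht
    rw [eq_weighted_mean_iff (by nlinarith)]
    field_simp

/-- The pooling equation in terms of the posterior mean, wherever `c⁻¹` is differentiable. -/
lemma poolingEquationAt (hf : IsTypeDensity f) (hc : GainsAtTop c θs) (h : PoolCurve f c θs 1 φ)
    (hx : x ∈ Ioc θs (c 1)) (hd : 0 < derivWithin c (Icc 0 1) (costInv c x)) :
    PoolingEquationAt f (matchInv (matching c φ θs) (φ 1) θs) (costInv c) (fun y => y)
      (Icc θs (c 1)) x := by
  have hs1 := hc.mem_Ioo.2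
  have hsub : Icc θs 1 ⊆ Icc 0 1 := Icc_subset_Icc_left hc.mem_Ioo.1.le
  have hcb := hc.cost_bijOn
  have hEq : EqOn (costInv c) (Function.invFunOn c (Icc θs 1)) (Icc θs (c 1)) := fun y hy => by
    obtain ⟨t, ht, rfl⟩ := hcb.surjOn hy
    rw [hcb.injOn.leftInvOn_invFunOn ht]
    exact hc.strictMonoOn.injOn.leftInvOn_invFunOn (hsub ht)
  have hbb : BijOn (costInv c) (Icc θs (c 1)) (Icc θs 1) :=
    hcb.bijOn_invFunOn.congr fun y hy => (hEq hy).symm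
  have hinv : ∀ y ∈ Icc θs (c 1), c (costInv c y) = y := fun y hy => by
    rw [hEq hy]
    exact hcb.invOn_invFunOn.2 hy
  have hbmono : StrictMonoOn (costInv c) (Icc θs (c 1)) := fun y hy z hz hyz => by
    rw [hEq hy, hEq hz]
    exact (hc.strictMonoOn.mono hsub).invFunOn hcb hy hz hyz
  have hx' := Ioc_subset_Icc_self hx
  set t := costInv c x with htdef
  have htm : t ∈ Icc θs 1 := hbb.mapsTo hx'
  have hct : c t = x := hinv x hx'
  have ht : t ∈ Ioc θs 1 := by
    refine ⟨htm.1.lt_of_ne fun hEq' => ?_, htm.2⟩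
    rw [← hEq', hc.fixed] at hct
    exact hx.1.ne hct
  have hcd : HasDerivWithinAt c (derivWithin c (Icc 0 1) t) (Icc 0 1) t :=
    (hc.contDiffOn.differentiableOn one_ne_zero t (hsub htm)).hasDerivWithinAt
  have hbd : HasDerivWithinAt (costInv c) (derivWithin c (Icc 0 1) t)⁻¹ (Icc θs (c 1)) x :=
    HasDerivWithinAt.of_leftInverse (hbmono.continuousOn_of_bijOn hbb x hx')
      (fun y hy => hsub (hbb.mapsTo hy)) hx' hcd hd.ne' hinv
  have haEq : EqOn (matchInv (matching c φ θs) (φ 1) θs) (fun y => φ (costInv c y))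
      (Icc θs (c 1)) := fun y hy => by
    have := h.matchInv_matching hf hc (hbb.mapsTo hy)
    rwa [hinv y hy] at this
  have had := ((h.deriv t ht).comp x hbd hbb.mapsTo).congr haEq (haEq hx')
  have hu := uniqueDiffOn_Icc hc.lt_cost_one x hx'
  refine ⟨had.differentiableWithinAt, hbd.differentiableWithinAt, ?_⟩
  rw [had.derivWithin hu, hbd.derivWithin hu, haEq hx']
  simp only [← htdef]
  have h1 := h.density_pos hf hc htm
  have h2 := sub_pos.mpr (h.lt_cost hc le_rfl ht)
  have h3 := hf.pos t (hsub htm)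
  have h4 := h.deriv_neg hf hc le_rfl ht
  have h5 : 0 < f (φ t) * -(-((t - c t) * f t / ((c t - φ t) * f (φ t)))) :=
    mul_pos h1 (neg_pos.mpr h4)
  have h6 := inv_pos.mpr hd
  have h7 := mul_pos h5 h6
  have h8 := mul_pos h3 h6
  rw [eq_weighted_mean_iff (by nlinarith)]
  rw [← hct]
  field_simp

lemma revealPool (hg : EqOn g (matching c φ θs) (Icc (φ 1) θs)) (hf : IsTypeDensity f)
    (hc : GainsAtTop c θs) (h : PoolCurve f c θs 1 φ) :
    RevealPool c φ θs 1 (namMean c g θs (φ 1)) := by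
  have hb := h.bijOn hf hc ⟨hc.mem_Ioo.2, le_rfl⟩
  have hs := (h.mapsTo (right_mem_Icc.mpr hc.mem_Ioo.2.le)).2
  constructor
  · intro t ht
    rw [namMean, if_neg (hs.trans ht.1.le).not_gt, if_neg ht.1.not_ge]
  · intro t ht
    have ht' := hb.mapsTo (Ioc_subset_Icc_self ht)
    rw [namMean, if_neg ht'.1.not_gt, if_pos ht'.2, hg ht',
      h.matching_apply hf hc (Ioc_subset_Icc_self ht)]
  · intro θ hθ
    rw [namMean, if_pos hθ.2]
  · intro θ hθ
    exact absurd hθ.2 hθ.1.not_ge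

end PoolCurve

/-- Two matching functions have the same pooling curve. -/
lemma IsMatching.unique (hf : IsTypeDensity f) (hc : GainsAtTop c θs) (h : PoolCurve f c θs 1 φ)
    (hg : IsMatching f c θs θl g) :
    θl = φ 1 ∧ EqOn g (PoolCurve.matching c φ θs) (Icc (φ 1) θs) := by
  obtain ⟨h', h1, hgc⟩ := hg.poolCurve hf hc
  have hs1 := hc.mem_Ioo.2
  have hEq := h'.eqOn hf hc h ⟨hs1, le_rfl⟩
  refine ⟨h1.symm.trans (hEq (right_mem_Icc.mpr hs1.le)), fun θ hθ => ?_⟩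
  obtain ⟨t, ht, rfl⟩ := (h.bijOn hf hc ⟨hs1, le_rfl⟩).surjOn hθ
  rw [h.matching_apply hf hc ht, ← hgc t ht]
  exact congrArg g (hEq ht).symm

end Matching

/-! ### The dual price -/

/-- The solution `q` of `q' = -q / (x - a x)` on `(p, r]`, continued by a constant beyond `r` and by
`0` up to `p`. If `a` crosses the level `θ` downwards at `x₀`, then `x ↦ q x * (x - θ)` has a strict
minimum at `x₀`, since its derivative is `q x * (θ - a x) / (x - a x)`. -/
lemma exists_price {a : ℝ → ℝ} {p r q₁ : ℝ} (hpr : p < r) (hq₁ : 0 < q₁) (ha : Continuous a)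
    (hap : ∀ y, p < y → a y < y) :
    ∃ q : ℝ → ℝ, Measurable q ∧ (∀ x ≤ p, q x = 0) ∧ (∀ x, p < x → 0 < q x) ∧
      AntitoneOn q (Ioi p) ∧ q r = q₁ ∧
      ∀ θ < p, ∀ x₀ ∈ Ioc p r, (∀ y ∈ Ioo p x₀, θ < a y) → (∀ y ∈ Ioo x₀ r, a y < θ) →
        ∀ x, p < x → x ≠ x₀ → q x₀ * (x₀ - θ) < q x * (x - θ) := by
  set k : ℝ → ℝ := fun y => (y - a y)⁻¹ with hk
  have hkc : ContinuousOn k (Ioi p) :=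
    (continuous_id.sub ha).continuousOn.inv₀ fun y hy => (sub_pos.mpr (hap y hy)).ne'
  set Q : ℝ → ℝ := fun x => q₁ * Real.exp (-∫ y in r..x, k y) with hQ
  have hQpos : ∀ x, 0 < Q x := fun x => mul_pos hq₁ (Real.exp_pos _)
  have hQd : ∀ x, p < x → HasDerivAt Q (-(k x * Q x)) x := by
    intro x hx
    have hii : IntervalIntegrable k volume r x := by
      refine (hkc.mono ?_).intervalIntegrable
      exact fun y hy => (lt_min hpr hx).trans_le hy.1
    have h1 : HasDerivAt (fun x => ∫ y in r..x, k y) (k x) x :=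
      intervalIntegral.integral_hasDerivAt_right hii
        (hkc.stronglyMeasurableAtFilter isOpen_Ioi x hx) (hkc.continuousAt (Ioi_mem_nhds hx))
    refine (h1.neg.exp.const_mul q₁).congr_deriv ?_
    simp only [hQ, Pi.neg_apply]
    ring
  have hQc : ContinuousOn Q (Ioi p) := fun x hx => (hQd x hx).continuousAt.continuousWithinAt
  have hQanti : AntitoneOn Q (Ioi p) := by
    refine antitoneOn_of_hasDerivWithinAt_nonpos (convex_Ioi p) hQc (f' := fun x => -(k x * Q x))
      (fun x hx => (hQd x (by rwa [interior_Ioi] at hx)).hasDerivWithinAt) fun x hx => ?_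
    rw [interior_Ioi] at hx
    exact neg_nonpos.mpr (mul_pos (inv_pos.mpr (sub_pos.mpr (hap x hx))) (hQpos x)).le
  set q : ℝ → ℝ := (Ioi p).indicator fun x => Q (min x r) with hq
  have hqQ : ∀ x ∈ Ioc p r, q x = Q x := fun x hx => by
    rw [hq, indicator_of_mem (show x ∈ Ioi p from hx.1), min_eq_left hx.2]
  have hqr : ∀ x, r ≤ x → q x = Q r := fun x hx => by
    rw [hq, indicator_of_mem (show x ∈ Ioi p from hpr.trans_le hx), min_eq_right hx]
  have hmin : ∀ x ∈ Ioi p, min x r ∈ Ioi p := fun x hx => lt_min hx hpr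
  refine ⟨q, ?_, fun x hx => indicator_of_notMem (s := Ioi p) (not_lt.mpr hx) _, fun x hx => ?_,
    fun x hx y hy hxy => ?_, ?_, ?_⟩
  · have hc : ContinuousOn (fun x => Q (min x r)) (Ioi p) :=
      hQc.comp (continuous_id.min continuous_const).continuousOn hmin
    rw [hq, ← piecewise_eq_indicator]
    exact hc.measurable_piecewise continuousOn_const measurableSet_Ioi
  · rw [hq, indicator_of_mem (show x ∈ Ioi p from hx)]
    exact hQpos _
  · rw [hq, indicator_of_mem hx, indicator_of_mem hy]
    exact hQanti (hmin x hx) (hmin y hy) (min_le_min hxy le_rfl)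
  · rw [hqr r le_rfl, hQ]
    simp
  intro θ hθ x₀ hx₀ hlow hhigh x hx hne
  set H : ℝ → ℝ := fun x => Q x * (x - θ) with hH
  have hHd : ∀ y, p < y → HasDerivAt H (Q y * k y * (θ - a y)) y := by
    intro y hy
    refine ((hQd y hy).mul ((hasDerivAt_id y).sub_const θ)).congr_deriv ?_
    have := (sub_pos.mpr (hap y hy)).ne'
    simp only [hk, id]
    field_simp
    ring
  have hHc : ContinuousOn H (Ioi p) := hQc.mul (continuous_id.sub continuous_const).continuousOn
  have hQk : ∀ y, p < y → 0 < Q y * k y := fun y hy =>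
    mul_pos (hQpos y) (inv_pos.mpr (sub_pos.mpr (hap y hy)))
  have hanti : StrictAntiOn H (Ioc p x₀) := by
    refine strictAntiOn_of_hasDerivWithinAt_neg (convex_Ioc _ _)
      (f' := fun y => Q y * k y * (θ - a y)) (hHc.mono fun y hy => hy.1)
      (fun y hy => (hHd y (interior_subset hy).1).hasDerivWithinAt) fun y hy => ?_
    rw [interior_Ioc] at hy
    exact mul_neg_of_pos_of_neg (hQk y hy.1) (sub_neg.mpr (hlow y hy))
  have hmono : StrictMonoOn H (Icc x₀ r) := by
    refine strictMonoOn_of_hasDerivWithinAt_pos (convex_Icc _ _)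
      (f' := fun y => Q y * k y * (θ - a y)) (hHc.mono fun y hy => hx₀.1.trans_le hy.1)
      (fun y hy => (hHd y (hx₀.1.trans_le (interior_subset hy).1)).hasDerivWithinAt) fun y hy => ?_
    rw [interior_Icc] at hy
    exact mul_pos (hQk y (hx₀.1.trans hy.1)) (sub_pos.mpr (hhigh y hy))
  have hx₀r : H x₀ ≤ H r :=
    hmono.monotoneOn (left_mem_Icc.mpr hx₀.2) (right_mem_Icc.mpr hx₀.2) hx₀.2
  rw [hqQ x₀ hx₀]
  rcases hne.lt_or_gt with hlt | hgt
  · rw [hqQ x ⟨hx, hlt.le.trans hx₀.2⟩]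
    exact hanti ⟨hx, hlt.le⟩ ⟨hx₀.1, le_rfl⟩ hlt
  · rcases le_or_gt x r with hxr | hxr
    · rw [hqQ x ⟨hx, hxr⟩]
      exact hmono (left_mem_Icc.mpr hx₀.2) ⟨hgt.le, hxr⟩ hgt
    · rw [hqr x hxr.le]
      exact hx₀r.trans_lt (mul_lt_mul_of_pos_left (by linarith) (hQpos r))

section DualPrice

variable {f c α g q T : ℝ → ℝ} {θs θl θ x : ℝ}

/-- `q x` is the shadow price of the martingale constraint at the posterior mean `x`. For an
inefficient type `θ` the cost `q x * (x - θ)` of a trading posterior mean is least at the mean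
assigned by the matching, and at the largest one `c 1 = g θl` for the types below `θl`. The value at
`c 1` makes the type `θl` indifferent between trading and being revealed. -/
structure DualPrice (c α g : ℝ → ℝ) (θs θl : ℝ) (q : ℝ → ℝ) : Prop where
  measurable : Measurable q
  eq_zero : ∀ x ≤ θs, q x = 0
  pos : ∀ x, θs < x → 0 < q x
  antitoneOn : AntitoneOn q (Ioi θs)
  cost_one : q (c 1) = α θl / (c 1 - θl)
  isMin : ∀ θ < θs, ∀ x, θs < x → x ≠ g (max θ θl) →
    q (g (max θ θl)) * (g (max θ θl) - θ) < q x * (x - θ)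

lemma IsMatching.apply_left (hc : GainsAtTop c θs) (hg : IsMatching f c θs θl g) :
    g θl = c 1 := by
  have hl := left_mem_Icc.mpr hg.mem_Ioo.2.le
  obtain ⟨θ, hθ, hθ1⟩ := hg.bijOn.surjOn (right_mem_Icc.mpr hc.lt_cost_one.le)
  refine le_antisymm (hg.bijOn.mapsTo hl).2 ?_
  rw [← hθ1]
  exact hg.strictAntiOn.antitoneOn hl hθ hθ.1

lemma IsMatching.apply_right (hc : GainsAtTop c θs) (hg : IsMatching f c θs θl g) :
    g θs = θs := by
  have hr := right_mem_Icc.mpr hg.mem_Ioo.2.le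
  obtain ⟨θ, hθ, hθ1⟩ := hg.bijOn.surjOn (left_mem_Icc.mpr hc.lt_cost_one.le)
  refine le_antisymm ?_ (hg.bijOn.mapsTo hr).1
  have := hg.strictAntiOn.antitoneOn hθ hr hθ.2
  rwa [hθ1] at this

lemma IsMatching.lt_apply (hc : GainsAtTop c θs) (hg : IsMatching f c θs θl g)
    (hθ : θ ∈ Ico θl θs) : θs < g θ := by
  have := hg.strictAntiOn (Ico_subset_Icc_self hθ) (right_mem_Icc.mpr hg.mem_Ioo.2.le) hθ.2
  rwa [hg.apply_right hc] at this

lemma exists_dualPrice (hc : GainsAtTop c θs) (hg : IsMatching f c θs θl g) (hα : 0 < α θl) :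
    ∃ q, DualPrice c α g θs θl q := by
  have hls := hg.mem_Ioo.2
  have hsc := hc.lt_cost_one
  have hab : BijOn (matchInv g θl θs) (Icc θs (c 1)) (Icc θl θs) := hg.bijOn.bijOn_invFunOn
  have haa : StrictAntiOn (matchInv g θl θs) (Icc θs (c 1)) := hg.strictAntiOn.invFunOn hg.bijOn
  set a : ℝ → ℝ := fun y => matchInv g θl θs (max θs (min (c 1) y)) with ha
  have hproj : ∀ y, max θs (min (c 1) y) ∈ Icc θs (c 1) := fun y =>
    ⟨le_max_left _ _, max_le hsc.le (min_le_left _ _)⟩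
  have haeq : ∀ y ∈ Icc θs (c 1), a y = matchInv g θl θs y := fun y hy => by
    simp only [ha, min_eq_right hy.2, max_eq_right hy.1]
  have hac : Continuous a := (haa.continuousOn_of_bijOn hab).comp_continuous
    (continuous_const.max (continuous_const.min continuous_id)) hproj
  have halt : ∀ y, θs < y → a y < y := fun y hy => (hab.mapsTo (hproj y)).2.trans_lt hy
  obtain ⟨q, h1, h2, h3, h4, h5, h6⟩ := exists_price hsc
    (div_pos hα (sub_pos.mpr (hls.trans hsc))) hac halt
  refine ⟨q, h1, h2, h3, h4, h5, fun θ hθ x hx hne => ?_⟩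
  have hm : max θ θl ∈ Ico θl θs := ⟨le_max_right _ _, max_lt hθ hls⟩
  have hm' := Ico_subset_Icc_self hm
  have hgm := hg.bijOn.mapsTo hm'
  have hinv : matchInv g θl θs (g (max θ θl)) = max θ θl := hg.bijOn.invOn_invFunOn.1 hm'
  refine h6 θ hθ _ ⟨hg.lt_apply hc hm, hgm.2⟩ (fun y hy => ?_) (fun y hy => ?_) x hx hne
  · have hy' : y ∈ Icc θs (c 1) := ⟨hy.1.le, hy.2.le.trans hgm.2⟩
    have := haa hy' hgm hy.2
    rw [hinv] at this
    rw [haeq y hy']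
    exact (le_max_left _ _).trans_lt this
  · have hy' : y ∈ Icc θs (c 1) := ⟨hgm.1.trans hy.1.le, hy.2.le⟩
    have := haa hgm hy' hy.1
    rw [hinv] at this
    rw [haeq y hy']
    -- For `θ ≤ θl` the optimal mean is `c 1`, and no `y` remains to its right.
    rcases le_total θl θ with hle | hle
    · rwa [max_eq_left hle] at this
    · rw [max_eq_right hle, hg.apply_left hc] at hy
      exact absurd hy.1 hy.2.not_gt

end DualPrice

/-! ### Feasible distributions -/

section Feasible

variable {f c α : ℝ → ℝ} {θs θl : ℝ} {π : Measure (ℝ × ℝ)}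

/-- The posterior means that avoid `[θs, s)`, where the price may be unbounded. -/
def awayFrom (θs s : ℝ) : Set (ℝ × ℝ) := {p | p.2 < θs ∨ s ≤ p.2}

lemma measurableSet_awayFrom {θs s : ℝ} : MeasurableSet (awayFrom θs s) :=
  (measurableSet_lt measurable_snd measurable_const).union
    (measurableSet_le measurable_const measurable_snd)

namespace IsFeasible

lemma map_fst (hπ : IsFeasible f c π) : π.map Prod.fst = prior f := by
  ext A hA
  rw [Measure.map_apply measurable_fst hA]
  exact hπ.bayesPlausible A hA

lemma ae_fst (hπ : IsFeasible f c π) {P : ℝ → Prop} (hP : ∀ᵐ θ ∂prior f, P θ) :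
    ∀ᵐ p ∂π, P p.1 := by
  rw [← hπ.map_fst] at hP
  exact ae_of_ae_map measurable_fst.aemeasurable hP

lemma ae_mem (hπ : IsFeasible f c π) :
    ∀ᵐ p ∂π, p.1 ∈ Icc (0 : ℝ) 1 ∧ p.2 ∈ Icc (0 : ℝ) 1 :=
  mem_ae_iff.mpr hπ.support

lemma ae_auxCost_le (hπ : IsFeasible f c π) : ∀ᵐ p ∂π, auxCost c p.1 ≤ p.2 := by
  rw [ae_iff]
  simpa using hπ.pricesAsMeans univ MeasurableSet.univ

lemma integrable_sub (hπ : IsFeasible f c π) : Integrable (fun p => p.2 - p.1) π := by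
  have := hπ.isProbabilityMeasure
  refine Integrable.of_bound (measurable_snd.sub measurable_fst).aestronglyMeasurable 1 ?_
  filter_upwards [hπ.ae_mem] with p hp
  rw [Real.norm_eq_abs, abs_le]
  constructor <;> linarith [hp.1.1, hp.1.2, hp.2.1, hp.2.2]

/-- If no type is above its posterior mean, then every type equals it, because the mean is an
average of the types. -/
lemma ae_eq_of_forall_le (hπ : IsFeasible f c π) {B : Set ℝ} (hB : MeasurableSet B)
    (hle : ∀ᵐ p ∂π, p.2 ∈ B → p.1 ≤ p.2) : ∀ᵐ p ∂π, p.2 ∈ B → p.1 = p.2 := by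
  have hBm : MeasurableSet {p : ℝ × ℝ | p.2 ∈ B} := measurable_snd hB
  have h0 := hπ.martingale B hB
  rw [integral_eq_zero_iff_of_nonneg_ae] at h0
  · filter_upwards [(ae_restrict_iff' hBm).mp h0] with p hp hpB
    exact (sub_eq_zero.mp (hp hpB)).symm
  · exact (ae_restrict_iff' hBm).mpr (hle.mono fun p hp hpB => sub_nonneg.mpr (hp hpB))
  · exact hπ.integrable_sub.integrableOn

/-- No mass sits at the posterior mean `θs`: efficient types cannot be sent there, and inefficient
types alone have a smaller mean. -/
lemma ae_snd_ne (hc : GainsAtTop c θs) (hπ : IsFeasible f c π) : ∀ᵐ p ∂π, p.2 ≠ θs := by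
  have h := hπ.ae_eq_of_forall_le (measurableSet_singleton θs) ?_
  · filter_upwards [h, hπ.ae_fst (ae_prior_ne θs)] with p h1 h2 h3
    exact h2 ((h1 h3).trans h3)
  · filter_upwards [hπ.ae_mem, hπ.ae_auxCost_le] with p h1 h2 h3
    rw [mem_singleton_iff] at h3
    rw [h3] at h2 ⊢
    by_contra hlt
    have hmem : p.1 ∈ Ioc θs 1 := ⟨not_le.mp hlt, h1.1.2⟩
    rw [hc.auxCost_of_gt hmem] at h2
    exact (hc.lt_cost hmem).not_ge h2

/-- The martingale condition against a bounded function of the posterior mean. -/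
lemma integral_mul_eq_zero (hπ : IsFeasible f c π) {h : ℝ → ℝ} (hh : Measurable h) {C : ℝ}
    (hC : ∀ x, ‖h x‖ ≤ C) :
    Integrable (fun p => h p.2 * (p.2 - p.1)) π ∧ ∫ p, h p.2 * (p.2 - p.1) ∂π = 0 := by
  have := hπ.isProbabilityMeasure
  have hint : Integrable (fun p => h p.2 * (p.2 - p.1)) π :=
    hπ.integrable_sub.bdd_mul (hh.comp measurable_snd).aestronglyMeasurable
      (.of_forall fun p => hC p.2)
  refine ⟨hint, ?_⟩
  have hle : MeasurableSpace.comap Prod.snd inferInstance ≤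
      (inferInstance : MeasurableSpace (ℝ × ℝ)) := measurable_snd.comap_le
  have hcond : 0 =ᵐ[π]
      π[fun p : ℝ × ℝ => p.2 - p.1 | MeasurableSpace.comap Prod.snd inferInstance] := by
    refine ae_eq_condExp_of_forall_setIntegral_eq hle hπ.integrable_sub
      (fun _ _ _ => integrableOn_zero) ?_ aestronglyMeasurable_zero
    rintro _ ⟨B, hB, rfl⟩ -
    have : ∫ p in Prod.snd ⁻¹' B, (p.2 - p.1) ∂π = 0 := hπ.martingale B hB
    simp [this]
  have hpull := condExp_mul_of_stronglyMeasurable_left (μ := π)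
    (m := MeasurableSpace.comap Prod.snd inferInstance)
    (f := fun p : ℝ × ℝ => h p.2) (g := fun p => p.2 - p.1)
    ((hh.comp (comap_measurable _)).stronglyMeasurable) hint hπ.integrable_sub
  rw [← integral_condExp hle]
  refine integral_eq_zero_of_ae ?_
  filter_upwards [hpull, hcond] with p h1 h2
  refine Eq.trans h1 ?_
  rw [Pi.mul_apply, ← h2, Pi.zero_apply, mul_zero]

lemma integrable_trade (hα_meas : AEMeasurable α (volume.restrict (Icc 0 1)))
    (hα_pos : ∀ θ ∈ Icc (0 : ℝ) 1, 0 < α θ) {M : ℝ} (hM : ∀ θ ∈ Icc (0 : ℝ) 1, α θ ≤ M)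
    (hπ : IsFeasible f c π) :
    Integrable (fun p : ℝ × ℝ => α p.1 * (if θs ≤ p.2 then 1 else 0)) π := by
  have := hπ.isProbabilityMeasure
  have hm : AEMeasurable (fun p : ℝ × ℝ => α p.1) π := by
    have h1 : AEMeasurable α (π.map Prod.fst) := by
      rw [hπ.map_fst]
      exact hα_meas.mono_ac prior_absolutelyContinuous
    exact h1.comp_measurable measurable_fst
  have hi : Measurable fun p : ℝ × ℝ => if θs ≤ p.2 then (1 : ℝ) else 0 :=
    Measurable.ite (measurableSet_le measurable_const measurable_snd) measurable_const
      measurable_const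
  refine Integrable.of_bound (hm.mul hi.aemeasurable).aestronglyMeasurable M ?_
  filter_upwards [hπ.ae_mem] with p hp
  have h1 := hα_pos p.1 hp.1
  have h2 := hM p.1 hp.1
  split_ifs
  · rw [mul_one, Real.norm_of_nonneg h1.le]
    exact h2
  · rw [mul_zero, norm_zero]
    exact h1.le.trans h2

/-- The posterior means outside `[θs, s)` exhaust all of them as `s` decreases to `θs`. -/
lemma aecover (hc : GainsAtTop c θs) (hπ : IsFeasible f c π) :
    AECover π atTop fun n : ℕ => awayFrom θs (θs + 1 / ((n : ℝ) + 1)) where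
  measurableSet _ := measurableSet_awayFrom
  ae_eventually_mem := by
    filter_upwards [hπ.ae_snd_ne hc] with p hp
    rcases hp.lt_or_gt with h | h
    · exact .of_forall fun n => .inl h
    · have : Tendsto (fun n : ℕ => θs + 1 / ((n : ℝ) + 1)) atTop (𝓝 (θs + 0)) :=
        tendsto_one_div_add_atTop_nhds_zero_nat.const_add θs
      rw [add_zero] at this
      exact (this.eventually_lt_const h).mono fun n hn => .inr hn.le

end IsFeasible

end Feasible

/-! ### Weak duality and complementary slackness -/

section Duality

variable {f c α g q : ℝ → ℝ} {θs θl θ x : ℝ} {π : Measure (ℝ × ℝ)}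

/-- The dual value of a type: its trading weight net of the cost of its posterior mean, and zero for
the types that are revealed. -/
noncomputable def typeValue (c α g q : ℝ → ℝ) (θs θl θ : ℝ) : ℝ :=
  if θ < θl then 0
  else α θ - q (namMean c g θs θl θ) * (namMean c g θs θl θ - θ)

/-- The slack of the dual constraint at the point `(θ, x)`. -/
noncomputable def slack (c α g q : ℝ → ℝ) (θs θl : ℝ) (p : ℝ × ℝ) : ℝ :=
  typeValue c α g q θs θl p.1 - α p.1 * (if θs ≤ p.2 then 1 else 0) + q p.2 * (p.2 - p.1)

lemma namMean_of_lt (h : θ < θl) : namMean c g θs θl θ = θ := if_pos h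

lemma namMean_of_mem (h : θ ∈ Icc θl θs) : namMean c g θs θl θ = g θ := by
  rw [namMean, if_neg h.1.not_gt, if_pos h.2]

lemma namMean_of_gt (hl : θl ≤ θs) (h : θs < θ) : namMean c g θs θl θ = c θ := by
  rw [namMean, if_neg (hl.trans h.le).not_gt, if_neg h.not_ge]

lemma typeValue_of_lt (h : θ < θl) : typeValue c α g q θs θl θ = 0 := if_pos h

lemma typeValue_of_ge (h : θl ≤ θ) : typeValue c α g q θs θl θ =
    α θ - q (namMean c g θs θl θ) * (namMean c g θs θl θ - θ) := if_neg h.not_gt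

/-- Trading at `c 1` is worth its cost for the inefficient types above `θl`, since the price at
`c 1` makes `θl` indifferent and `α θ / (c 1 - θ)` is strictly increasing. -/
lemma DualPrice.cost_one_mul_lt (hc : GainsAtTop c θs) (hg : IsMatching f c θs θl g)
    (hq : DualPrice c α g θs θl q)
    (hratio : StrictMonoOn (fun θ => α θ / (c 1 - θ)) (Icc 0 θs)) (hθ : θ ∈ Ioc θl θs) :
    q (c 1) * (c 1 - θ) < α θ := by
  have h1 := hratio ⟨hg.mem_Ioo.1.le, hg.mem_Ioo.2.le⟩ ⟨hg.mem_Ioo.1.le.trans hθ.1.le, hθ.2⟩ hθ.1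
  have h2 := hc.lt_cost_one
  rw [hq.cost_one]
  exact (lt_div_iff₀ (by linarith [hθ.2])).mp h1

/-- Trading at `c 1`, the cheapest mean for the types below `θl`, is not worth its cost for them. -/
lemma DualPrice.lt_cost_one_mul (hc : GainsAtTop c θs) (hg : IsMatching f c θs θl g)
    (hq : DualPrice c α g θs θl q)
    (hratio : StrictMonoOn (fun θ => α θ / (c 1 - θ)) (Icc 0 θs)) (hθ : θ ∈ Ico 0 θl) :
    α θ < q (c 1) * (c 1 - θ) := by
  have hls := hg.mem_Ioo.2
  have h1 := hratio ⟨hθ.1, hθ.2.le.trans hls.le⟩ ⟨hg.mem_Ioo.1.le, hls.le⟩ hθ.2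
  have h2 := hc.lt_cost_one
  rw [hq.cost_one]
  exact (div_lt_iff₀ (by linarith [hθ.2])).mp h1

lemma DualPrice.isMin_le (hq : DualPrice c α g θs θl q) (hθ : θ < θs) (hx : θs < x) :
    q (g (max θ θl)) * (g (max θ θl) - θ) ≤ q x * (x - θ) := by
  rcases eq_or_ne x (g (max θ θl)) with rfl | hne
  · exact le_rfl
  · exact (hq.isMin θ hθ x hx hne).le

lemma typeValue_pos (hc : GainsAtTop c θs) (hg : IsMatching f c θs θl g)
    (hq : DualPrice c α g θs θl q)
    (hα_pos : ∀ θ ∈ Icc (0 : ℝ) 1, 0 < α θ)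
    (hratio : StrictMonoOn (fun θ => α θ / (c 1 - θ)) (Icc 0 θs))
    (hθ : θ ∈ Ioc θl 1) (hne : θ ≠ θs) : 0 < typeValue c α g q θs θl θ := by
  rw [typeValue_of_ge hθ.1.le, sub_pos]
  rcases hne.lt_or_gt with h | h
  · rw [namMean_of_mem ⟨hθ.1.le, h.le⟩]
    have h1 := hq.isMin_le h hc.lt_cost_one
    rw [max_eq_left hθ.1.le] at h1
    exact h1.trans_lt (hq.cost_one_mul_lt hc hg hratio ⟨hθ.1, h.le⟩)
  · rw [namMean_of_gt hg.mem_Ioo.2.le h]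
    have h1 := hc.below θ ⟨h, hθ.2⟩
    have h2 := hq.pos _ (hc.lt_cost ⟨h, hθ.2⟩)
    have h3 := hα_pos θ ⟨hg.mem_Ioo.1.le.trans hθ.1.le, hθ.2⟩
    nlinarith

/-- Dual feasibility together with complementary slackness: the slack is nonnegative, and it
vanishes only where `x` is the mean assigned by the matching or `θ` is a type below `θl` that does
not trade. -/
lemma slack_pos_or (hc : GainsAtTop c θs) (hg : IsMatching f c θs θl g)
    (hq : DualPrice c α g θs θl q) (hα_pos : ∀ θ ∈ Icc (0 : ℝ) 1, 0 < α θ)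
    (hratio : StrictMonoOn (fun θ => α θ / (c 1 - θ)) (Icc 0 θs))
    (hθ : θ ∈ Icc (0 : ℝ) 1) (hs : θ ≠ θs) (hl : θ ≠ θl) (hx : x ≠ θs) (hcx : auxCost c θ ≤ x) :
    0 < slack c α g q θs θl (θ, x) ∨
      slack c α g q θs θl (θ, x) = 0 ∧ (x = namMean c g θs θl θ ∨ θ < θl ∧ x < θs) := by
  have hls := hg.mem_Ioo.2
  rcases hl.lt_or_gt with h | h
  · rcases hx.lt_or_gt with hxs | hxs
    · refine .inr ⟨?_, .inr ⟨h, hxs⟩⟩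
      simp only [slack, typeValue_of_lt h, if_neg hxs.not_ge, hq.eq_zero x hxs.le]
      ring
    · left
      simp only [slack, typeValue_of_lt h, if_pos hxs.le]
      have h1 := hq.isMin_le (h.trans hls) hxs
      rw [max_eq_right h.le, hg.apply_left hc] at h1
      have h2 := hq.lt_cost_one_mul hc hg hratio ⟨hθ.1, h⟩
      linarith
  have hv := typeValue_pos hc hg hq hα_pos hratio ⟨h, hθ.2⟩ hs
  rcases hx.lt_or_gt with hxs | hxs
  · left
    simp only [slack, if_neg hxs.not_ge, hq.eq_zero x hxs.le]
    linarith
  rw [slack]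
  simp only [if_pos hxs.le, typeValue_of_ge h.le]
  rcases hs.lt_or_gt with hθs | hθs
  · rw [namMean_of_mem ⟨h.le, hθs.le⟩]
    rcases eq_or_ne x (g θ) with rfl | hne
    · exact .inr ⟨by ring, .inl rfl⟩
    · left
      have := hq.isMin θ hθs x hxs
      rw [max_eq_left h.le] at this
      linarith [this hne]
  · have hmem : θ ∈ Ioc θs 1 := ⟨hθs, hθ.2⟩
    rw [namMean_of_gt hls.le hθs]
    rw [hc.auxCost_of_gt hmem] at hcx
    rcases hcx.eq_or_lt with rfl | hlt
    · exact .inr ⟨by ring, .inl rfl⟩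
    · left
      have h1 := hc.lt_cost hmem
      have h2 := hq.antitoneOn h1 hxs hcx
      have h3 := hc.below θ hmem
      have h4 := hq.pos x hxs
      nlinarith [mul_le_mul_of_nonneg_right h2 (sub_nonneg.mpr h3.le)]

lemma slack_namMean (hc : GainsAtTop c θs) (hg : IsMatching f c θs θl g)
    (hθ : θ ∈ Icc (0 : ℝ) 1) :
    slack c α g q θs θl (θ, namMean c g θs θl θ) = 0 := by
  have hls := hg.mem_Ioo.2
  rcases lt_or_ge θ θl with h | h
  · simp only [slack, typeValue_of_lt h, namMean_of_lt h, if_neg (h.trans hls).not_ge]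
    ring
  · have hge : θs ≤ namMean c g θs θl θ := by
      rcases le_or_gt θ θs with h1 | h1
      · rw [namMean_of_mem ⟨h, h1⟩]
        exact (hg.bijOn.mapsTo ⟨h, h1⟩).1
      · rw [namMean_of_gt hls.le h1]
        exact (hc.lt_cost ⟨h1, hθ.2⟩).le
    simp only [slack, typeValue_of_ge h, if_pos hge]
    ring

lemma DualPrice.integral_awayFrom (hq : DualPrice c α g θs θl q) (hπ : IsFeasible f c π) {s : ℝ}
    (hs : θs < s) :
    IntegrableOn (fun p => q p.2 * (p.2 - p.1)) (awayFrom θs s) π ∧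
      ∫ p in awayFrom θs s, q p.2 * (p.2 - p.1) ∂π = 0 := by
  have hqs := hq.pos s hs
  have hbd : ∀ x, ‖(Ici s).indicator q x‖ ≤ q s := fun x => by
    by_cases hx : x ∈ Ici s
    · rw [indicator_of_mem hx, Real.norm_of_nonneg (hq.pos x (hs.trans_le hx)).le]
      exact hq.antitoneOn hs (hs.trans_le hx) hx
    · rw [indicator_of_notMem hx, norm_zero]
      exact hqs.le
  obtain ⟨h1, h2⟩ := hπ.integral_mul_eq_zero (hq.measurable.indicator measurableSet_Ici) hbd
  have heq : (fun p : ℝ × ℝ => (Ici s).indicator q p.2 * (p.2 - p.1)) =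
      (awayFrom θs s).indicator fun p => q p.2 * (p.2 - p.1) := by
    ext p
    by_cases hp : s ≤ p.2
    · rw [indicator_of_mem (show p.2 ∈ Ici s from hp),
        indicator_of_mem (show p ∈ awayFrom θs s from .inr hp)]
    · rw [indicator_of_notMem (show p.2 ∉ Ici s from hp), zero_mul]
      by_cases hp' : p ∈ awayFrom θs s
      · rw [indicator_of_mem hp', hq.eq_zero _ (hp'.resolve_right hp).le, zero_mul]
      · rw [indicator_of_notMem hp']
  rw [heq] at h1 h2
  rw [integral_indicator measurableSet_awayFrom] at h2
  exact ⟨(integrable_indicator_iff measurableSet_awayFrom).mp h1, h2⟩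

end Duality

section Optimality

variable {f c α g q : ℝ → ℝ} {θs θl θ x : ℝ} {π : Measure (ℝ × ℝ)}

lemma ae_nam_snd_eq (hT : AEMeasurable (namMean c g θs θl) (prior f))
    (hnam : IsFeasible f c (nam f c g θs θl)) :
    ∀ᵐ p ∂nam f c g θs θl, p.2 = namMean c g θs θl p.1 := by
  have h1 : ∀ᵐ p ∂nam f c g θs θl, p.2 = hT.mk _ p.1 := by
    refine (ae_map_iff (aemeasurable_id.prodMk hT)
      (measurableSet_eq_fun measurable_snd (hT.measurable_mk.comp measurable_fst))).mpr ?_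
    exact hT.ae_eq_mk
  filter_upwards [h1, hnam.ae_fst hT.ae_eq_mk] with p h2 h3
  rw [h2, h3]

lemma eq_nam_of_ae (hT : AEMeasurable (namMean c g θs θl) (prior f)) (hπ : IsFeasible f c π)
    (h : ∀ᵐ p ∂π, p.2 = namMean c g θs θl p.1) : π = nam f c g θs θl := by
  rw [nam, ← hπ.map_fst, AEMeasurable.map_map_of_aemeasurable
    (by rw [hπ.map_fst]; exact aemeasurable_id.prodMk hT) measurable_fst.aemeasurable]
  refine Measure.map_id.symm.trans (Measure.map_congr ?_)
  filter_upwards [h] with p hp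
  exact Prod.ext rfl hp

lemma ae_typeValue_nonneg (hc : GainsAtTop c θs) (hg : IsMatching f c θs θl g)
    (hq : DualPrice c α g θs θl q) (hα_pos : ∀ θ ∈ Icc (0 : ℝ) 1, 0 < α θ)
    (hratio : StrictMonoOn (fun θ => α θ / (c 1 - θ)) (Icc 0 θs)) :
    ∀ᵐ θ ∂prior f, 0 ≤ typeValue c α g q θs θl θ := by
  filter_upwards [ae_prior_mem_Icc, ae_prior_ne θs, ae_prior_ne θl] with θ h1 h2 h3
  rcases h3.lt_or_gt with h | h
  · exact (typeValue_of_lt h).ge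
  · exact (typeValue_pos hc hg hq hα_pos hratio ⟨h, h1.2⟩ h2).le

/-- The price times the pooling error may fail to be integrable near `θs`, but the dual value of the
types is integrable: under the matching itself it differs from the trade weights by a term that
integrates to zero away from `θs`. -/
lemma integrable_typeValue (hc : GainsAtTop c θs) (hg : IsMatching f c θs θl g)
    (hq : DualPrice c α g θs θl q) (hα_meas : AEMeasurable α (volume.restrict (Icc 0 1)))
    (hα_pos : ∀ θ ∈ Icc (0 : ℝ) 1, 0 < α θ) {M : ℝ} (hM : ∀ θ ∈ Icc (0 : ℝ) 1, α θ ≤ M)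
    (hratio : StrictMonoOn (fun θ => α θ / (c 1 - θ)) (Icc 0 θs))
    (hT : AEMeasurable (namMean c g θs θl) (prior f))
    (hnam : IsFeasible f c (nam f c g θs θl)) :
    Integrable (typeValue c α g q θs θl) (prior f) := by
  set v := typeValue c α g q θs θl with hv
  have hvm : AEMeasurable v (prior f) := by
    have h1 : AEMeasurable (fun θ => α θ - q (namMean c g θs θl θ) * (namMean c g θs θl θ - θ))
        (prior f) :=
      (hα_meas.mono_ac prior_absolutelyContinuous).sub
        ((hq.measurable.comp_aemeasurable hT).mul (hT.sub aemeasurable_id))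
    refine (h1.indicator (measurableSet_Ici (a := θl))).congr (.of_forall fun θ => ?_)
    by_cases h : θ < θl
    · rw [indicator_of_notMem (show θ ∉ Ici θl from not_le.mpr h), hv, typeValue_of_lt h]
    · rw [indicator_of_mem (show θ ∈ Ici θl from not_lt.mp h), hv, typeValue_of_ge (not_lt.mp h)]
  have hI := hnam.integrable_trade hα_meas hα_pos hM (θs := θs)
  have hI0 : 0 ≤ᵐ[nam f c g θs θl] fun p => α p.1 * (if θs ≤ p.2 then 1 else 0) := by
    filter_upwards [hnam.ae_mem] with p hp
    exact mul_nonneg (hα_pos _ hp.1).le (by split_ifs <;> norm_num)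
  have hs0 : ∀ᵐ p ∂nam f c g θs θl, v p.1 =
      α p.1 * (if θs ≤ p.2 then 1 else 0) - q p.2 * (p.2 - p.1) := by
    filter_upwards [ae_nam_snd_eq hT hnam, hnam.ae_mem] with p h1 h2
    have h3 := slack_namMean (α := α) (q := q) hc hg h2.1
    rw [← h1] at h3
    simp only [slack] at h3
    linarith
  suffices h : Integrable (fun p : ℝ × ℝ => v p.1) (nam f c g θs θl) by
    rw [← hnam.map_fst]
    rw [← hnam.map_fst] at hvm
    exact (integrable_map_measure hvm.aestronglyMeasurable measurable_fst.aemeasurable).mpr h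
  have hloc : ∀ n : ℕ, IntegrableOn (fun p : ℝ × ℝ => v p.1)
      (awayFrom θs (θs + 1 / ((n : ℝ) + 1))) (nam f c g θs θl) ∧
      ∫ p in awayFrom θs (θs + 1 / ((n : ℝ) + 1)), v p.1 ∂nam f c g θs θl ≤
        tradeVolume α θs (nam f c g θs θl) := by
    intro n
    obtain ⟨h1, h2⟩ := hq.integral_awayFrom hnam
      (lt_add_of_pos_right θs (Nat.one_div_pos_of_nat (n := n)))
    refine ⟨(hI.integrableOn.sub h1).congr ((ae_restrict_of_ae hs0).mono fun p hp => hp.symm), ?_⟩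
    rw [integral_congr_ae (ae_restrict_of_ae hs0), integral_sub hI.integrableOn h1, h2, sub_zero]
    exact setIntegral_le_integral hI hI0
  exact (hnam.aecover hc).integrable_of_integral_bounded_of_nonneg_ae _ (fun n => (hloc n).1)
    (hnam.ae_fst (ae_typeValue_nonneg hc hg hq hα_pos hratio)) (.of_forall fun n => (hloc n).2)

/-- The duality gap: away from the posterior mean `θs`, the total slack of a feasible distribution
tends to the dual value minus the trade volume. -/
lemma IsFeasible.tendsto_integral_slack (hc : GainsAtTop c θs) (hq : DualPrice c α g θs θl q)
    (hα_meas : AEMeasurable α (volume.restrict (Icc 0 1)))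
    (hα_pos : ∀ θ ∈ Icc (0 : ℝ) 1, 0 < α θ) {M : ℝ} (hM : ∀ θ ∈ Icc (0 : ℝ) 1, α θ ≤ M)
    (hv : Integrable (typeValue c α g q θs θl) (prior f)) (hπ : IsFeasible f c π) :
    (∀ n : ℕ, IntegrableOn (slack c α g q θs θl) (awayFrom θs (θs + 1 / ((n : ℝ) + 1))) π) ∧
    Tendsto (fun n : ℕ => ∫ p in awayFrom θs (θs + 1 / ((n : ℝ) + 1)), slack c α g q θs θl p ∂π)
      atTop (𝓝 (∫ θ, typeValue c α g q θs θl θ ∂prior f - tradeVolume α θs π)) := by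
  have hI := hπ.integrable_trade hα_meas hα_pos hM (θs := θs)
  have hvm := hv
  rw [← hπ.map_fst] at hvm
  have hvπ : Integrable (fun p : ℝ × ℝ => typeValue c α g q θs θl p.1) π :=
    hvm.comp_measurable measurable_fst
  have hvI : ∫ p, typeValue c α g q θs θl p.1 ∂π = ∫ θ, typeValue c α g q θs θl θ ∂prior f := by
    rw [← hπ.map_fst, integral_map measurable_fst.aemeasurable hvm.aestronglyMeasurable]
  have hloc : ∀ n : ℕ, _ := fun n => hq.integral_awayFrom hπ
    (lt_add_of_pos_right θs (Nat.one_div_pos_of_nat (n := n)))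
  have hlim := (hπ.aecover hc).integral_tendsto_of_countably_generated (hvπ.sub hI)
  refine ⟨fun n => ((hvπ.sub hI).integrableOn.add (hloc n).1), ?_⟩
  have hgap : ∫ p, ((fun p : ℝ × ℝ => typeValue c α g q θs θl p.1) -
      fun p : ℝ × ℝ => α p.1 * (if θs ≤ p.2 then 1 else 0)) p ∂π =
      ∫ θ, typeValue c α g q θs θl θ ∂prior f - tradeVolume α θs π := by
    simp only [Pi.sub_apply]
    rw [integral_sub hvπ hI, hvI, tradeVolume]
  rw [hgap] at hlim
  refine hlim.congr fun n => ?_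
  have := integral_add (hvπ.sub hI).integrableOn (hloc n).1
  rw [(hloc n).2, add_zero] at this
  exact this.symm

lemma IsFeasible.ae_slack_pos_or (hc : GainsAtTop c θs) (hg : IsMatching f c θs θl g)
    (hq : DualPrice c α g θs θl q) (hα_pos : ∀ θ ∈ Icc (0 : ℝ) 1, 0 < α θ)
    (hratio : StrictMonoOn (fun θ => α θ / (c 1 - θ)) (Icc 0 θs)) (hπ : IsFeasible f c π) :
    ∀ᵐ p ∂π, 0 < slack c α g q θs θl p ∨ slack c α g q θs θl p = 0 ∧
      (p.2 = namMean c g θs θl p.1 ∨ p.1 < θl ∧ p.2 < θs) := by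
  filter_upwards [hπ.ae_mem, hπ.ae_fst (ae_prior_ne θs), hπ.ae_fst (ae_prior_ne θl),
    hπ.ae_snd_ne hc, hπ.ae_auxCost_le] with p h1 h2 h3 h4 h5
  exact slack_pos_or hc hg hq hα_pos hratio h1.1 h2 h3 h4 h5

lemma tradeVolume_nam (hc : GainsAtTop c θs) (hg : IsMatching f c θs θl g)
    (hq : DualPrice c α g θs θl q) (hα_meas : AEMeasurable α (volume.restrict (Icc 0 1)))
    (hα_pos : ∀ θ ∈ Icc (0 : ℝ) 1, 0 < α θ) {M : ℝ} (hM : ∀ θ ∈ Icc (0 : ℝ) 1, α θ ≤ M)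
    (hv : Integrable (typeValue c α g q θs θl) (prior f))
    (hT : AEMeasurable (namMean c g θs θl) (prior f))
    (hnam : IsFeasible f c (nam f c g θs θl)) :
    tradeVolume α θs (nam f c g θs θl) = ∫ θ, typeValue c α g q θs θl θ ∂prior f := by
  have h0 : ∀ᵐ p ∂nam f c g θs θl, slack c α g q θs θl p = 0 := by
    filter_upwards [ae_nam_snd_eq hT hnam, hnam.ae_mem] with p h1 h2
    have h3 := slack_namMean (α := α) (q := q) hc hg h2.1
    rwa [← h1] at h3
  have h := (hnam.tendsto_integral_slack hc hq hα_meas hα_pos hM hv).2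
  have hz : ∀ n : ℕ, ∫ p in awayFrom θs (θs + 1 / ((n : ℝ) + 1)),
      slack c α g q θs θl p ∂nam f c g θs θl = 0 := fun n =>
    integral_eq_zero_of_ae (ae_restrict_of_ae h0)
  simp only [hz] at h
  exact (sub_eq_zero.mp (tendsto_nhds_unique h tendsto_const_nhds)).symm

/-- Strong duality and uniqueness: a feasible distribution trades at most the dual value, and if it
attains it then its slack vanishes almost everywhere, which leaves only the matching. -/
lemma IsFeasible.tradeVolume_le_and_eq (hc : GainsAtTop c θs) (hg : IsMatching f c θs θl g)
    (hq : DualPrice c α g θs θl q) (hα_meas : AEMeasurable α (volume.restrict (Icc 0 1)))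
    (hα_pos : ∀ θ ∈ Icc (0 : ℝ) 1, 0 < α θ) {M : ℝ} (hM : ∀ θ ∈ Icc (0 : ℝ) 1, α θ ≤ M)
    (hratio : StrictMonoOn (fun θ => α θ / (c 1 - θ)) (Icc 0 θs))
    (hv : Integrable (typeValue c α g q θs θl) (prior f))
    (hT : AEMeasurable (namMean c g θs θl) (prior f)) (hπ : IsFeasible f c π) :
    tradeVolume α θs π ≤ ∫ θ, typeValue c α g q θs θl θ ∂prior f ∧
      (∫ θ, typeValue c α g q θs θl θ ∂prior f ≤ tradeVolume α θs π → π = nam f c g θs θl) := by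
  obtain ⟨hint, hlim⟩ := hπ.tendsto_integral_slack hc hq hα_meas hα_pos hM hv
  have hslack := hπ.ae_slack_pos_or hc hg hq hα_pos hratio
  have h0 : 0 ≤ᵐ[π] slack c α g q θs θl := hslack.mono fun p hp =>
    hp.elim (fun h => h.le) fun h => h.1.ge
  have hnn : ∀ n : ℕ, 0 ≤ ∫ p in awayFrom θs (θs + 1 / ((n : ℝ) + 1)), slack c α g q θs θl p ∂π :=
    fun n => integral_nonneg_of_ae (ae_restrict_of_ae h0)
  refine ⟨sub_nonneg.mp (ge_of_tendsto' hlim hnn), fun hle => ?_⟩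
  have hmono : Monotone fun n : ℕ =>
      ∫ p in awayFrom θs (θs + 1 / ((n : ℝ) + 1)), slack c α g q θs θl p ∂π := by
    intro m n hmn
    refine setIntegral_mono_set (hint n) (ae_restrict_of_ae h0)
      (LE.le.eventuallyLE fun p hp => hp.imp id fun h => le_trans ?_ h)
    have := one_div_le_one_div_of_le (Nat.cast_add_one_pos (α := ℝ) m)
      (add_le_add_left (Nat.cast_le.mpr hmn) 1)
    linarith
  have hzero : ∀ n : ℕ, ∫ p in awayFrom θs (θs + 1 / ((n : ℝ) + 1)),
      slack c α g q θs θl p ∂π = 0 := fun n =>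
    le_antisymm ((hmono.ge_of_tendsto hlim n).trans (sub_nonpos.mpr hle)) (hnn n)
  have hae0 : ∀ᵐ p ∂π, slack c α g q θs θl p = 0 := by
    have h1 : ∀ᵐ p ∂π, ∀ n : ℕ, p ∈ awayFrom θs (θs + 1 / ((n : ℝ) + 1)) →
        slack c α g q θs θl p = 0 := by
      refine ae_all_iff.mpr fun n => ?_
      exact (ae_restrict_iff' measurableSet_awayFrom).mp
        ((integral_eq_zero_iff_of_nonneg_ae (ae_restrict_of_ae h0) (hint n)).mp (hzero n))
    filter_upwards [h1, (hπ.aecover hc).ae_eventually_mem] with p h2 h3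
    obtain ⟨n, hn⟩ := h3.exists
    exact h2 n hn
  have hcase : ∀ᵐ p ∂π, p.2 = namMean c g θs θl p.1 ∨ p.1 < θl ∧ p.2 < θs := by
    filter_upwards [hslack, hae0] with p h1 h2
    exact h1.elim (fun h => absurd h2 h.ne') fun h => h.2
  -- The types that do not trade are revealed, since each of them is at most its posterior mean.
  have hrev := hπ.ae_eq_of_forall_le (measurableSet_Iio (a := θs)) ?_
  · refine eq_nam_of_ae hT hπ ?_
    filter_upwards [hcase, hrev] with p h1 h2
    rcases h1 with h1 | ⟨h1, h3⟩
    · exact h1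
    · rw [namMean_of_lt h1]
      exact (h2 h3).symm
  · filter_upwards [hcase, hπ.ae_mem, hπ.ae_auxCost_le] with p h1 h2 h3 h4
    have hlt : p.1 ≤ θs := by
      rcases h1 with h1 | h1
      · by_contra hgt
        rw [namMean_of_gt hg.mem_Ioo.2.le (not_le.mp hgt)] at h1
        have := hc.lt_cost ⟨not_le.mp hgt, h2.1.2⟩
        rw [← h1] at this
        exact this.not_gt h4
      · exact h1.1.le.trans hg.mem_Ioo.2.le
    rwa [hc.auxCost_of_le h2.1.1 hlt] at h3

end Optimality

end Lemons

theorem proposition2 (f c α : ℝ → ℝ) (θs : ℝ)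
    (hf : Lemons.IsTypeDensity f)
    (hc : Lemons.GainsAtTop c θs)
    (hα_meas : AEMeasurable α (volume.restrict (Icc 0 1)))
    (hα_pos : ∀ θ ∈ Icc (0 : ℝ) 1, 0 < α θ)
    (hα_bdd : ∃ M : ℝ, ∀ θ ∈ Icc (0 : ℝ) 1, α θ ≤ M)
    (hfull : Lemons.NoFullTrade f c θs)
    (hratio : ∀ x ∈ Icc θs (c 1), StrictMonoOn (fun θ => α θ / (x - θ)) (Icc 0 θs \ {x})) :
    ∃ (θl : ℝ) (g : ℝ → ℝ),
      Lemons.IsMatching f c θs θl g ∧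
      (∀ (θl' : ℝ) (g' : ℝ → ℝ), Lemons.IsMatching f c θs θl' g' →
        θl' = θl ∧ EqOn g' g (Icc θl θs)) ∧
      (∀ x ∈ Ioc θs (c 1), 0 < derivWithin c (Icc 0 1) (Lemons.costInv c x) →
        Lemons.PoolingEquationAt f (Lemons.matchInv g θl θs) (Lemons.costInv c) (fun y => y)
          (Icc θs (c 1)) x) ∧
      Lemons.IsSolution f c α θs (Lemons.nam f c g θs θl) ∧
      (∀ π : Measure (ℝ × ℝ), Lemons.IsSolution f c α θs π → π = Lemons.nam f c g θs θl) := by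
  open Lemons in
  obtain ⟨M, hM⟩ := hα_bdd
  obtain ⟨τ, hτ, φ, h, hφτ⟩ := exists_poolCurve hf hc
  have hpos := h.pos_of_noFullTrade hf hc hfull hτ
  obtain rfl : τ = 1 := hφτ.resolve_left hpos.ne'
  have hg := h.isMatching hf hc hpos
  have hT := PoolCurve.revealPool (fun _ _ => rfl) hf hc h
  have hTm := hT.aemeasurable hf hc h hτ
  have hnam : IsFeasible f c (nam f c (PoolCurve.matching c φ θs) θs (φ 1)) :=
    hT.isFeasible hf hc h hτ
  have hφ1 : φ 1 ∈ Icc (0 : ℝ) 1 := h.mem_unit hc (right_mem_Icc.mpr hτ.1.le)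
  have hsc := hc.lt_cost_one
  have hratio' : StrictMonoOn (fun θ => α θ / (c 1 - θ)) (Icc 0 θs) :=
    (hratio (c 1) (right_mem_Icc.mpr hsc.le)).mono fun θ hθ =>
      ⟨hθ, (hθ.2.trans_lt hsc).ne⟩
  obtain ⟨q, hq⟩ := exists_dualPrice hc hg (hα_pos _ hφ1)
  have hv := integrable_typeValue hc hg hq hα_meas hα_pos hM hratio' hTm hnam
  have hopt := tradeVolume_nam hc hg hq hα_meas hα_pos hM hv hTm hnam
  refine ⟨φ 1, PoolCurve.matching c φ θs, hg, fun θl' g' hg' => hg'.unique hf hc h,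
    fun x hx hd => h.poolingEquationAt hf hc hx hd, ⟨hnam, fun π hπ => ?_⟩, fun π hπ => ?_⟩
  · rw [hopt]
    exact (hπ.tradeVolume_le_and_eq hc hg hq hα_meas hα_pos hM hratio' hv hTm).1
  · refine (hπ.1.tradeVolume_le_and_eq hc hg hq hα_meas hα_pos hM hratio' hv hTm).2 ?_
    rw [← hopt]
    exact hπ.2 _ hnam
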